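/- Let $n$ be a positive integer and let $\mathcal M$ be a model category that has all small limits. Write $\boldsymbol\Delta$ for the simplex category, $\boldsymbol\Delta^n$ for its $n$-fold power and $D\colon\boldsymbol\Delta\to\boldsymbol\Delta^n$ for the diagonal embedding. For a functor $X\colon\boldsymbol\Delta^n\to\mathcal M$ (an $n$-cosimplicial object) put $\operatorname{diag}X=X\circ D$, and similarly for functors to $\mathcal M^{\boldsymbol\Delta^{\mathrm{op}}}$. Let $\mathcal C$ be a Reedy category ($\boldsymbol\Delta$ or $\boldsymbol\Delta^n$) and $X\colon\mathcal C\to\mathcal M$. A *Reedy simplicial frame* on $X$ is a functor $\widehat X\colon\mathcal C\to\mathcal M^{\boldsymbol\Delta^{\mathrm{op}}}$ together with a natural map $j\colon \mathrm{cs}_*X\to\widehat X$ from the diagram of constant simplicial objects such that, for every object $\alpha$ of $\mathcal C$, the map $j_\alpha\colon \mathrm{cs}_*X_\alpha\to\widehat X_\alpha$ is a degreewise weak equivalence that is an isomorphism in degree $0$, and $\widehat X_\alpha$ is a Reedy fibrant simplicial object whenever $X_\alpha$ is fibrant; and such that, if $X$ is a Reedy fibrant $\mathcal C$-diagram in $\mathcal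 M$, then $\widehat X$ is a Reedy fibrant $\mathcal C$-diagram in $\mathcal M^{\boldsymbol\Delta^{\mathrm{op}}}$ (where the fibrations of $\mathcal M^{\boldsymbol\Delta^{\mathrm{op}}}$ are the Reedy fibrations). A map from $(X,\widehat X,j)$ to $(Y,\widehat Y,j')$ is a pair of natural maps $X\to Y$, $\widehat X\to\widehat Y$ compatible with $j$ and $j'$. For a simplicial object $A$ of $\mathcal M$ and a simplicial set $K$, let $A^K$ be the limit, over the opposite of the category of simplices of $K$, of the diagram that sends an $m$-simplex of $K$ to $A_m$. Let $\Delta^{(n)}$ be the $n$-cosimplicial simplicial set $([p_1],\dots,[p_n])\mapsto \boldsymbol\Delta^n\bigl(D-,([p_1],\dots,[p_n])\bigr)=\Delta[p_1]\times\cdots\times\Delta[p_n]$, and let $\Delta$ be the cosimplicial simplicial set $[k]\mapsto\Delta[k]$. The total object of an $n$-cosimplicial object $X$ with Reedy simplicial frame $\widehat X$ is the end $\operatorname{Tot}X=\int_{\vec p\in\boldsymbol\Delta^n}(\widehat X^{\vec p})^{\Delta^{(n)}(\vec p)}$, and the total object of a cosimplicial object $Y$ with Reedy simplicial frame $\widehat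 Y$ is the end $\operatorname{Tot}Y=\int_{[k]\in\boldsymbol\Delta}(\widehat Y^{k})^{\Delta[k]}$. **Theorem.** If $X$ is an $n$-cosimplicial object in $\mathcal M$ and $\widehat X$ is a Reedy simplicial frame on $X$, then $\operatorname{diag}\widehat X$ is a Reedy simplicial frame on $\operatorname{diag}X$, and there is an isomorphism $$\operatorname{Tot}X\;\cong\;\operatorname{Tot}(\operatorname{diag}X),$$ where the right-hand side is formed with the frame $\operatorname{diag}\widehat X$. This isomorphism is natural with respect to maps of $n$-cosimplicial objects with Reedy simplicial frames. -/

import Mathlib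

open CategoryTheory CategoryTheory.Limits HomotopicalAlgebra Opposite

universe v u

noncomputable section

/-! ### Matching objects and Reedy fibrations

For diagrams indexed by a Reedy category `C`, matching objects and Reedy fibrations depend only on
the inverse subcategory of `C`, which is recorded here as a class of morphisms `W`. -/

namespace Reedy

section Matching

variable {C : Type} [SmallCategory C] (W : MorphismProperty C) [W.IsMultiplicative]
variable {N : Type u} [Category.{v} N]

/-- The matching category at `α`: the full subcategory of the category of objects under `α` in the
inverse subcategory, containing all objects except the identity map of `α`. -/
abbrev MatchingCategory (α : C) : Type :=
  ObjectProperty.FullSubcategory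
    (fun f : W.Under W α => ¬ MorphismProperty.identities C f.hom)

/-- The functor from the matching category to `C` sending `α ⟶ β` to `β`. -/
abbrev matchingForget (α : C) : MatchingCategory W α ⥤ C :=
  ObjectProperty.ι _ ⋙ MorphismProperty.Under.forget W W α ⋙ CategoryTheory.Under.forget α

variable [HasLimitsOfSize.{0, 0} N]

/-- The matching object of `X` at `α`. -/
def matchingObj (X : C ⥤ N) (α : C) : N :=
  limit (matchingForget W α ⋙ X)

/-- The projection `M_α X ⟶ X_β` at an object `α ⟶ β` of the matching category. -/
def matchingπ (X : C ⥤ N) (α : C) (f : MatchingCategory W α) :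
    matchingObj W X α ⟶ X.obj f.obj.right :=
  limit.π (matchingForget W α ⋙ X) f

theorem matchingObj_hom_ext {X : C ⥤ N} {α : C} {Z : N} {f g : Z ⟶ matchingObj W X α}
    (h : ∀ j, f ≫ matchingπ W X α j = g ≫ matchingπ W X α j) : f = g :=
  limit.hom_ext h

/-- The matching map `X_α ⟶ M_α X`; its component at `f : α ⟶ β` is `X(f)`. -/
def matchingMap (X : C ⥤ N) (α : C) : X.obj α ⟶ matchingObj W X α :=
  limit.lift (matchingForget W α ⋙ X)
    { pt := X.obj α
      π :=
        { app := fun f => X.map f.obj.hom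
          naturality := fun f g φ => by
            have h : g.obj.hom = f.obj.hom ≫ φ.hom.right := by
              have := φ.hom.w
              simpa using this
            change 𝟙 _ ≫ X.map g.obj.hom = X.map f.obj.hom ≫ X.map φ.hom.right
            rw [h, Category.id_comp, X.map_comp] } }

theorem matchingMap_π (X : C ⥤ N) (α : C) (j : MatchingCategory W α) :
    matchingMap W X α ≫ matchingπ W X α j = X.map j.obj.hom :=
  limit.lift_π _ _

/-- The map `M_α X ⟶ M_α Y` induced by `f : X ⟶ Y`. -/
def matchingObjMap {X Y : C ⥤ N} (f : X ⟶ Y) (α : C) :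
    matchingObj W X α ⟶ matchingObj W Y α :=
  limMap (Functor.whiskerLeft (matchingForget W α) f)

theorem matchingObjMap_π {X Y : C ⥤ N} (f : X ⟶ Y) (α : C) (j : MatchingCategory W α) :
    matchingObjMap W f α ≫ matchingπ W Y α j = matchingπ W X α j ≫ f.app j.obj.right :=
  limMap_π _ _

theorem matchingMap_naturality {X Y : C ⥤ N} (f : X ⟶ Y) (α : C) :
    f.app α ≫ matchingMap W Y α = matchingMap W X α ≫ matchingObjMap W f α := by
  apply matchingObj_hom_ext
  intro j
  rw [Category.assoc, Category.assoc, matchingMap_π, matchingObjMap_π, ← Category.assoc,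
    matchingMap_π]
  exact (f.naturality j.obj.hom).symm

/-- The relative matching map `X_α ⟶ Y_α ×_{M_α Y} M_α X`. -/
def relMatchingMap {X Y : C ⥤ N} (f : X ⟶ Y) (α : C) :
    X.obj α ⟶ pullback (matchingMap W Y α) (matchingObjMap W f α) :=
  pullback.lift (f.app α) (matchingMap W X α) (matchingMap_naturality W f α)

/-- The Reedy fibrations of `C`-diagrams in a category `N` whose class of fibrations is `P`:
all the relative matching maps belong to `P`. -/
def reedyFibrations (P : MorphismProperty N) : MorphismProperty (C ⥤ N) :=
  fun _ _ f => ∀ α : C, P (relMatchingMap W f α)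

/-- A diagram is Reedy fibrant if its map to the terminal diagram is a Reedy fibration. -/
def IsFibrantDiagram (P : MorphismProperty N) (X : C ⥤ N) : Prop :=
  reedyFibrations W P (terminal.from X)

end Matching

/-! ### The indexing categories -/

/-- The product category `Δⁿ`. -/
abbrev MultiSimplex (n : ℕ) : Type := Fin n → SimplexCategory

/-- The inverse subcategory of `Δ`: the epimorphisms of `Δ` are the surjective maps. -/
abbrev simplexInverse : MorphismProperty SimplexCategory :=
  MorphismProperty.epimorphisms SimplexCategory

/-- The inverse subcategory of `Δⁿ`: the componentwise surjective maps. -/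
abbrev multiInverse (n : ℕ) : MorphismProperty (MultiSimplex n) :=
  MorphismProperty.pi (fun _ => simplexInverse)

/-- The inverse subcategory of `Δᵒᵖ`: the opposites of the injective maps of `Δ`. -/
abbrev simplexOpInverse : MorphismProperty SimplexCategoryᵒᵖ :=
  (MorphismProperty.monomorphisms SimplexCategory).op

instance multiInverse_isMultiplicative (n : ℕ) : (multiInverse n).IsMultiplicative where
  id_mem _ := fun _ => simplexInverse.id_mem _
  comp_mem _ _ hf hg := fun i => simplexInverse.comp_mem _ _ (hf i) (hg i)

/-- The diagonal embedding `D : Δ ⥤ Δⁿ`. -/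
abbrev diagonal (n : ℕ) : SimplexCategory ⥤ MultiSimplex n :=
  Functor.pi' (fun _ => 𝟭 SimplexCategory)

/-! ### Simplicial sets

A simplicial set is a functor `SimplexCategoryᵒᵖ ⥤ Type`. -/

/-- The cosimplicial standard simplex `[k] ↦ Δ[k] = Δ(-, [k])`. -/
abbrev stdSimplex : SimplexCategory ⥤ (SimplexCategoryᵒᵖ ⥤ Type) := yoneda

/-- The `n`-cosimplicial product of standard simplices `Δ⁽ⁿ⁾`, which sends `([p₁], …, [pₙ])` to
`Δⁿ(D -, ([p₁], …, [pₙ])) = Δ[p₁] × ⋯ × Δ[pₙ]`. -/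
abbrev prodStdSimplex (n : ℕ) : MultiSimplex n ⥤ (SimplexCategoryᵒᵖ ⥤ Type) :=
  yoneda ⋙ (Functor.whiskeringLeft _ _ _).obj (diagonal n).op

/-! ### Homotopy cotensors and ends -/

section Cotensor

variable (M : Type u) [Category.{v} M] [HasLimitsOfSize.{0, 0} M]

variable {M} in
/-- The homotopy cotensor `A^K` of a simplicial object `A` and a simplicial set `K`: the limit over
the opposite of the category of simplices of `K` of the diagram that sends an `m`-simplex of `K` to
`A_m`. (The objects of `K.Elements` are the simplices of `K`, and its morphisms from `τ` to `σ` are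
the simplicial operators that take `τ` to `σ`.) -/
def cotensorObj (K : SimplexCategoryᵒᵖ ⥤ Type) (A : SimplexCategoryᵒᵖ ⥤ M) : M :=
  limit (CategoryOfElements.π K ⋙ A)

variable {M} in
/-- The projection `A^K ⟶ A_m` at an `m`-simplex of `K`. -/
def cotensorπ (K : SimplexCategoryᵒᵖ ⥤ Type) (A : SimplexCategoryᵒᵖ ⥤ M)
    {m : SimplexCategoryᵒᵖ} (x : K.obj m) : cotensorObj K A ⟶ A.obj m :=
  limit.π (CategoryOfElements.π K ⋙ A) ⟨m, x⟩

variable {M} in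
theorem cotensorπ_map (K : SimplexCategoryᵒᵖ ⥤ Type) (A : SimplexCategoryᵒᵖ ⥤ M)
    {m k : SimplexCategoryᵒᵖ} (x : K.obj m) (f : m ⟶ k) :
    cotensorπ K A x ≫ A.map f = cotensorπ K A (K.map f x) :=
  limit.w (CategoryOfElements.π K ⋙ A)
    (j := ⟨m, x⟩) (j' := ⟨k, K.map f x⟩) ⟨f, rfl⟩

variable {M} in
theorem cotensorObj_hom_ext {K : SimplexCategoryᵒᵖ ⥤ Type} {A : SimplexCategoryᵒᵖ ⥤ M} {Z : M}
    {f g : Z ⟶ cotensorObj K A}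
    (h : ∀ (m : SimplexCategoryᵒᵖ) (x : K.obj m), f ≫ cotensorπ K A x = g ≫ cotensorπ K A x) :
    f = g :=
  limit.hom_ext (fun j => h j.1 j.2)

variable {M} in
/-- The map `A^K ⟶ B^L` induced by `g : L ⟶ K` and `f : A ⟶ B`. -/
def cotensorMap {K L : SimplexCategoryᵒᵖ ⥤ Type} {A B : SimplexCategoryᵒᵖ ⥤ M}
    (g : L ⟶ K) (f : A ⟶ B) : cotensorObj K A ⟶ cotensorObj L B :=
  limit.lift (CategoryOfElements.π L ⋙ B)
    { pt := cotensorObj K A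
      π :=
        { app := fun σ => cotensorπ K A (g.app σ.1 σ.2) ≫ f.app σ.1
          naturality := fun σ τ φ => by
            have h : g.app τ.1 τ.2 = K.map φ.1 (g.app σ.1 σ.2) := by
              rw [← NatTrans.naturality_apply, φ.2]
            change 𝟙 _ ≫ cotensorπ K A (g.app τ.1 τ.2) ≫ f.app τ.1 =
              (cotensorπ K A (g.app σ.1 σ.2) ≫ f.app σ.1) ≫ B.map φ.1
            rw [h, ← cotensorπ_map, Category.id_comp, Category.assoc, Category.assoc,
              f.naturality] } }

variable {M} in
theorem cotensorMap_π {K L : SimplexCategoryᵒᵖ ⥤ Type} {A B : SimplexCategoryᵒᵖ ⥤ M}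
    (g : L ⟶ K) (f : A ⟶ B) {m : SimplexCategoryᵒᵖ} (x : L.obj m) :
    cotensorMap g f ≫ cotensorπ L B x = cotensorπ K A (g.app m x) ≫ f.app m :=
  limit.lift_π _ _

/-- The homotopy cotensor `A^K` as a functor, contravariant in `K` and covariant in `A`. -/
def cotensor : (SimplexCategoryᵒᵖ ⥤ Type)ᵒᵖ ⥤ (SimplexCategoryᵒᵖ ⥤ M) ⥤ M where
  obj K :=
    { obj := fun A => cotensorObj K.unop A
      map := fun f => cotensorMap (𝟙 K.unop) f
      map_id := fun A => cotensorObj_hom_ext fun m x => by simp [cotensorMap_π]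
      map_comp := fun f g => cotensorObj_hom_ext fun m x => by
        simp only [Category.assoc, cotensorMap_π]
        rw [← Category.assoc, cotensorMap_π]
        simp }
  map g :=
    { app := fun A => cotensorMap g.unop (𝟙 A)
      naturality := fun A B f => cotensorObj_hom_ext fun m x => by
        simp only [Category.assoc, cotensorMap_π]
        rw [← Category.assoc, ← Category.assoc, cotensorMap_π, cotensorMap_π]
        simp }
  map_id K := by
    apply NatTrans.ext
    funext A
    apply cotensorObj_hom_ext
    intro m x
    change cotensorMap (𝟙 K.unop) (𝟙 A) ≫ _ = 𝟙 (cotensorObj K.unop A) ≫ _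
    simp [cotensorMap_π]
  map_comp g h := by
    apply NatTrans.ext
    funext A
    apply cotensorObj_hom_ext
    intro m x
    change cotensorMap (h.unop ≫ g.unop) (𝟙 A) ≫ _ =
      (cotensorMap g.unop (𝟙 A) ≫ cotensorMap h.unop (𝟙 A)) ≫ _
    simp only [Category.assoc, cotensorMap_π]
    rw [← Category.assoc, cotensorMap_π]
    simp

variable {M} {C : Type} [SmallCategory C]

/-- The functor `(α, β) ↦ (A_β)^(K_α)`, contravariant in `α` and covariant in `β`. -/
abbrev cotensorBifunctor (K : C ⥤ (SimplexCategoryᵒᵖ ⥤ Type)) (A : C ⥤ (SimplexCategoryᵒᵖ ⥤ M)) :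
    Cᵒᵖ ⥤ C ⥤ M :=
  K.op ⋙ cotensor M ⋙ (Functor.whiskeringLeft C _ M).obj A

/-- The end of `(α, β) ↦ (A_β)^(K_α)`, as a functor of `A`. -/
def homEnd (K : C ⥤ (SimplexCategoryᵒᵖ ⥤ Type)) : (C ⥤ (SimplexCategoryᵒᵖ ⥤ M)) ⥤ M where
  obj A := end_ (cotensorBifunctor K A)
  map f := end_.map
    (Functor.whiskerLeft K.op
      (Functor.whiskerLeft (cotensor M) ((Functor.whiskeringLeft C _ M).map f)))
  map_id A := by
    rw [CategoryTheory.Functor.map_id, Functor.whiskerLeft_id', Functor.whiskerLeft_id']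
    exact end_.map_id
  map_comp f g := by
    rw [CategoryTheory.Functor.map_comp, Functor.whiskerLeft_comp, Functor.whiskerLeft_comp]
    exact (end_.map_comp _ _).symm

end Cotensor

/-! ### Frames and total objects -/

section Frames

variable {C : Type} [SmallCategory C]
variable {M : Type u} [Category.{v} M]

/-- The `C`-diagram of constant simplicial objects on a `C`-diagram in `M`. -/
abbrev cs (X : C ⥤ M) : C ⥤ (SimplexCategoryᵒᵖ ⥤ M) :=
  X ⋙ Functor.const SimplexCategoryᵒᵖ

variable [ModelCategory M] [HasLimitsOfSize.{0, 0} M]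

/-- `j : cs_* A ⟶ A'` exhibits `A'` as a simplicial frame on the object `A` of `M`: it is a
(degreewise) weak equivalence, it is an isomorphism in degree `0`, and `A'` is a Reedy fibrant
simplicial object if `A` is fibrant. -/
structure IsFrame {A : M} {A' : SimplexCategoryᵒᵖ ⥤ M}
    (j : (Functor.const SimplexCategoryᵒᵖ).obj A ⟶ A') : Prop where
  weakEquivalence : ∀ m : SimplexCategoryᵒᵖ, WeakEquivalence (j.app m)
  isIso_zero : IsIso (j.app (op (SimplexCategory.mk 0)))
  fibrant : IsFibrant A → IsFibrantDiagram simplexOpInverse (HomotopicalAlgebra.fibrations M) A'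

variable (W : MorphismProperty C) [W.IsMultiplicative]

/-- `j : cs_* X ⟶ X'` exhibits `X'` as a Reedy simplicial frame on the `C`-diagram `X`, where `C` is
a Reedy category with inverse subcategory `W`: it is objectwise a simplicial frame, and if `X` is
Reedy fibrant, then so is `X'` as a `C`-diagram in the Reedy model category of simplicial objects. -/
structure IsReedyFrame {X : C ⥤ M} {X' : C ⥤ (SimplexCategoryᵒᵖ ⥤ M)} (j : cs X ⟶ X') : Prop where
  isFrame : ∀ α : C, IsFrame (A := X.obj α) (A' := X'.obj α) (j.app α)
  fibrant : IsFibrantDiagram W (HomotopicalAlgebra.fibrations M) X →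
    IsFibrantDiagram W (reedyFibrations simplexOpInverse (HomotopicalAlgebra.fibrations M)) X'

variable (M)

/-- A `C`-diagram in `M` together with a Reedy simplicial frame on it. -/
structure FramedDiagram where
  diagram : C ⥤ M
  frame : C ⥤ (SimplexCategoryᵒᵖ ⥤ M)
  j : cs diagram ⟶ frame
  isReedyFrame : IsReedyFrame W j

namespace FramedDiagram

variable {W M}

/-- A map of framed diagrams: a map of diagrams and a compatible map of frames. -/
@[ext]
structure Hom (X Y : FramedDiagram M W) where
  diagram : X.diagram ⟶ Y.diagram
  frame : X.frame ⟶ Y.frame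
  comm : X.j ≫ frame =
    Functor.whiskerRight diagram (Functor.const SimplexCategoryᵒᵖ) ≫ Y.j

instance : Category (FramedDiagram M W) where
  Hom := Hom
  id X :=
    { diagram := 𝟙 _
      frame := 𝟙 _
      comm := by simp }
  comp {_ _ _} f g :=
    { diagram := f.diagram ≫ g.diagram
      frame := f.frame ≫ g.frame
      comm := by
        rw [← Category.assoc, f.comm, Category.assoc, g.comm, Functor.whiskerRight_comp,
          Category.assoc] }

end FramedDiagram

variable {W M} in
/-- The functor that sends a framed diagram to its frame. -/
@[simps]
def FramedDiagram.frameFunctor : FramedDiagram M W ⥤ (C ⥤ (SimplexCategoryᵒᵖ ⥤ M)) where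
  obj X := X.frame
  map f := Hom.frame f

/-- The total object `Tot X` of a cosimplicial object `X` with Reedy simplicial frame `X'`: the end
of `X'^Δ`. -/
def tot : FramedDiagram M simplexInverse ⥤ M :=
  FramedDiagram.frameFunctor ⋙ homEnd stdSimplex

/-- The total object `Tot X` of an `n`-cosimplicial object `X` with Reedy simplicial frame `X'`: the
end of `X'^(Δ⁽ⁿ⁾)`. -/
def multiTot (n : ℕ) : FramedDiagram M (multiInverse n) ⥤ M :=
  FramedDiagram.frameFunctor ⋙ homEnd (prodStdSimplex n)

variable {M}

/-- The diagonal `cs_* (diag X) ⟶ diag X'` of `j : cs_* X ⟶ X'`. -/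
def diagJ {n : ℕ} {X : MultiSimplex n ⥤ M} {X' : MultiSimplex n ⥤ (SimplexCategoryᵒᵖ ⥤ M)}
    (j : cs X ⟶ X') : cs (diagonal n ⋙ X) ⟶ diagonal n ⋙ X' :=
  (Functor.associator _ _ _).hom ≫ Functor.whiskerLeft (diagonal n) j

/-- If diagonals of Reedy simplicial frames are Reedy simplicial frames, then `X ↦ diag X`, with the
frame `diag X'`, is a functor. -/
def diagFunctor {n : ℕ}
    (h : ∀ X : FramedDiagram M (multiInverse n), IsReedyFrame simplexInverse (diagJ X.j)) :
    FramedDiagram M (multiInverse n) ⥤ FramedDiagram M simplexInverse where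
  obj X :=
    { diagram := diagonal n ⋙ X.diagram
      frame := diagonal n ⋙ X.frame
      j := diagJ X.j
      isReedyFrame := h X }
  map {X Y} f :=
    { diagram := Functor.whiskerLeft (diagonal n) (FramedDiagram.Hom.diagram f)
      frame := Functor.whiskerLeft (diagonal n) (FramedDiagram.Hom.frame f)
      comm := by
        have h := FramedDiagram.Hom.comm f
        apply NatTrans.ext
        funext α
        have h' := NatTrans.congr_app h ((diagonal n).obj α)
        change (𝟙 _ ≫ X.j.app _) ≫ f.frame.app _ = _ ≫ 𝟙 _ ≫ Y.j.app _
        rw [Category.id_comp, Category.id_comp]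
        exact h' }
  map_id X := rfl
  map_comp f g := rfl

end Frames

end Reedy

end

/-! Total objects. An m-simplex of Δ⁽ⁿ⁾(p) is a map x : D[m] ⟶ p, that is, the image under x of the
identity simplex of Δ⁽ⁿ⁾(D[m]). By this Yoneda argument a map into the end of A^(Δ⁽ⁿ⁾) is determined
by its components at identity simplices, a family with values in (A_{D[m]})_m that is compatible
with all maps of Δ. The end of (diag A)^Δ is described by the same families, so restriction to the
diagonal is an isomorphism, natural in A (`nonempty_homEnd_diagonal_iso`).

Frames. Only the fibrancy clause needs work: if diag X is Reedy fibrant, then X must be, so that the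
frame on X is Reedy fibrant, and then so must be its diagonal. Both implications follow from one
criterion: an n-cosimplicial object is Reedy fibrant if and only if its diagonal is
(`IsDetectedBy.isFibrantDiagram_diagonal_iff`).

The criterion is reduced to sets. Fibrations of the model category are detected by lifting against
trivial cofibrations, and Reedy fibrations by derived lifting problems. Each such problem is a
transformation between limit preserving functors to types, so no boundary object has to be
represented by a colimit. Reedy fibrancy becomes the extension of compatible families from the
non-split-monomorphisms out of each object (`HasBoundaryExtensions`). To pass to the diagonal, a
family on the boundary of [k] is spread over a cosieve of maps out of D[k] and extended there by
induction on degree. To come back, ([p₁], …, [pₙ]) is made a retract of D[p₁ + ⋯ + pₙ] by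
concatenating the simplices. -/

noncomputable section

namespace Reedy

/-! ### Ends of cotensors as families indexed by simplices -/

section HomEnd

variable {M : Type u} [Category.{v} M] [HasLimitsOfSize.{0, 0} M] {C : Type} [SmallCategory C]

/-- The projection `∫ (A_c)^(K_c) ⟶ (A_c)^(K_c)`. -/
def homEndProj (K : C ⥤ (SimplexCategoryᵒᵖ ⥤ Type)) (A : C ⥤ (SimplexCategoryᵒᵖ ⥤ M)) (c : C) :
    (homEnd K).obj A ⟶ cotensorObj (K.obj c) (A.obj c) :=
  end_.π (cotensorBifunctor K A) c

/-- The projection of the end `∫ (A_c)^(K_c)` at an `m`-simplex of `K_c`. -/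
def homEndπ (K : C ⥤ (SimplexCategoryᵒᵖ ⥤ Type)) (A : C ⥤ (SimplexCategoryᵒᵖ ⥤ M)) (c : C)
    {m : SimplexCategoryᵒᵖ} (x : (K.obj c).obj m) : (homEnd K).obj A ⟶ (A.obj c).obj m :=
  homEndProj K A c ≫ cotensorπ (K.obj c) (A.obj c) x

variable {K : C ⥤ (SimplexCategoryᵒᵖ ⥤ Type)} {A B : C ⥤ (SimplexCategoryᵒᵖ ⥤ M)}

theorem homEndProj_condition {c d : C} (f : c ⟶ d) :
    homEndProj K A c ≫ cotensorMap (𝟙 (K.obj c)) (A.map f) =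
      homEndProj K A d ≫ cotensorMap (K.map f) (𝟙 (A.obj d)) :=
  end_.condition (cotensorBifunctor K A) f

theorem homEndProj_hom_ext {Z : M} {f g : Z ⟶ (homEnd K).obj A}
    (h : ∀ c : C, f ≫ homEndProj K A c = g ≫ homEndProj K A c) : f = g :=
  end_.hom_ext h

theorem exists_homEndProj_lift {Z : M} (z : ∀ c : C, Z ⟶ cotensorObj (K.obj c) (A.obj c))
    (hz : ∀ ⦃c d : C⦄ (f : c ⟶ d), z c ≫ cotensorMap (𝟙 (K.obj c)) (A.map f) =
      z d ≫ cotensorMap (K.map f) (𝟙 (A.obj d))) :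
    ∃ l : Z ⟶ (homEnd K).obj A, ∀ c : C, l ≫ homEndProj K A c = z c :=
  ⟨end_.lift (F := cotensorBifunctor K A) z hz,
    fun c => end_.lift_π (F := cotensorBifunctor K A) z hz c⟩

theorem homEnd_map_proj (f : A ⟶ B) (c : C) :
    (homEnd K).map f ≫ homEndProj K B c =
      homEndProj K A c ≫ cotensorMap (𝟙 (K.obj c)) (f.app c) :=
  end_.map_π (F := cotensorBifunctor K A) (F' := cotensorBifunctor K B) _ c

theorem homEndπ_simplicial (c : C) {m k : SimplexCategoryᵒᵖ} (x : (K.obj c).obj m) (f : m ⟶ k) :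
    homEndπ K A c x ≫ (A.obj c).map f = homEndπ K A c ((K.obj c).map f x) := by
  rw [homEndπ, Category.assoc, cotensorπ_map, homEndπ]

theorem homEndπ_map {c d : C} {m : SimplexCategoryᵒᵖ} (x : (K.obj c).obj m) (f : c ⟶ d) :
    homEndπ K A c x ≫ (A.map f).app m = homEndπ K A d ((K.map f).app m x) := by
  have h := homEndProj_condition (K := K) (A := A) f =≫ cotensorπ (K.obj c) (A.obj d) x
  rw [Category.assoc, Category.assoc, cotensorMap_π, cotensorMap_π] at h
  simpa [homEndπ] using h

theorem homEnd_hom_ext {Z : M} {f g : Z ⟶ (homEnd K).obj A}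
    (h : ∀ (c : C) (m : SimplexCategoryᵒᵖ) (x : (K.obj c).obj m),
      f ≫ homEndπ K A c x = g ≫ homEndπ K A c x) : f = g := by
  refine homEndProj_hom_ext fun c => cotensorObj_hom_ext fun m x => ?_
  have := h c m x
  simpa only [homEndπ, Category.assoc] using this

/-- A family of maps `Z ⟶ A_m` indexed by the `m`-simplices of `K` defines a map `Z ⟶ A^K`. -/
def cotensorLift {K : SimplexCategoryᵒᵖ ⥤ Type} {A : SimplexCategoryᵒᵖ ⥤ M} {Z : M}
    (z : ∀ m : SimplexCategoryᵒᵖ, K.obj m → (Z ⟶ A.obj m))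
    (hz : ∀ (m k : SimplexCategoryᵒᵖ) (x : K.obj m) (f : m ⟶ k),
      z m x ≫ A.map f = z k (K.map f x)) : Z ⟶ cotensorObj K A :=
  limit.lift (CategoryOfElements.π K ⋙ A)
    { pt := Z
      π :=
        { app := fun σ => z σ.1 σ.2
          naturality := fun σ τ φ => by
            change 𝟙 _ ≫ z τ.1 τ.2 = z σ.1 σ.2 ≫ A.map φ.1
            rw [hz, Category.id_comp, φ.2] } }

theorem cotensorLift_π {K : SimplexCategoryᵒᵖ ⥤ Type} {A : SimplexCategoryᵒᵖ ⥤ M} {Z : M}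
    (z : ∀ m : SimplexCategoryᵒᵖ, K.obj m → (Z ⟶ A.obj m))
    (hz : ∀ (m k : SimplexCategoryᵒᵖ) (x : K.obj m) (f : m ⟶ k),
      z m x ≫ A.map f = z k (K.map f x)) {m : SimplexCategoryᵒᵖ} (x : K.obj m) :
    cotensorLift z hz ≫ cotensorπ K A x = z m x :=
  limit.lift_π _ _

/-- Unfolds the end and the cotensor limits inside it at once; `hz` handles the simplicial operators
and `hz'` the maps of `C`. -/
theorem exists_homEnd_lift {Z : M}
    (z : ∀ (c : C) (m : SimplexCategoryᵒᵖ), (K.obj c).obj m → (Z ⟶ (A.obj c).obj m))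
    (hz : ∀ (c : C) (m k : SimplexCategoryᵒᵖ) (x : (K.obj c).obj m) (f : m ⟶ k),
      z c m x ≫ (A.obj c).map f = z c k ((K.obj c).map f x))
    (hz' : ∀ (c d : C) (m : SimplexCategoryᵒᵖ) (x : (K.obj c).obj m) (f : c ⟶ d),
      z c m x ≫ (A.map f).app m = z d m ((K.map f).app m x)) :
    ∃ l : Z ⟶ (homEnd K).obj A, ∀ (c : C) (m : SimplexCategoryᵒᵖ) (x : (K.obj c).obj m),
      l ≫ homEndπ K A c x = z c m x := by
  obtain ⟨l, hl⟩ := exists_homEndProj_lift (K := K) (A := A) (fun c => cotensorLift (z c) (hz c))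
    (by
      intro c d f
      refine cotensorObj_hom_ext fun m x => ?_
      rw [Category.assoc, Category.assoc, cotensorMap_π, cotensorMap_π, ← Category.assoc,
        ← Category.assoc, cotensorLift_π, cotensorLift_π]
      simpa using hz' c d m x f)
  refine ⟨l, fun c m x => ?_⟩
  rw [homEndπ, ← Category.assoc, hl, cotensorLift_π]

theorem homEnd_map_π (f : A ⟶ B) (c : C) {m : SimplexCategoryᵒᵖ} (x : (K.obj c).obj m) :
    (homEnd K).map f ≫ homEndπ K B c x = homEndπ K A c x ≫ (f.app c).app m := by
  rw [homEndπ, ← Category.assoc, homEnd_map_proj, Category.assoc, cotensorMap_π, homEndπ,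
    Category.assoc]
  simp

end HomEnd

/-! ### The isomorphism of total objects -/

section Diagonal

variable {M : Type u} [Category.{v} M] [HasLimitsOfSize.{0, 0} M] (n : ℕ)

/-- Restricting the end of `A^(Δ⁽ⁿ⁾)` to the diagonal. -/
theorem exists_homEnd_restrict (A : MultiSimplex n ⥤ (SimplexCategoryᵒᵖ ⥤ M)) :
    ∃ l : (homEnd (prodStdSimplex n)).obj A ⟶ (homEnd stdSimplex).obj (diagonal n ⋙ A),
      ∀ (k : SimplexCategory) (m : SimplexCategoryᵒᵖ) (y : (stdSimplex.obj k).obj m),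
        l ≫ homEndπ stdSimplex (diagonal n ⋙ A) k y =
          homEndπ (prodStdSimplex n) A ((diagonal n).obj k) (m := m) ((diagonal n).map y) := by
  refine exists_homEnd_lift (K := stdSimplex) (A := diagonal n ⋙ A)
    (fun k m y => homEndπ (prodStdSimplex n) A ((diagonal n).obj k) (m := m)
      ((diagonal n).map y)) ?_ ?_
  · intro k m m' y f
    exact homEndπ_simplicial (K := prodStdSimplex n) (A := A) _ _ f
  · intro k k' m y f
    exact homEndπ_map (K := prodStdSimplex n) (A := A) _ ((diagonal n).map f)

/-- The projection of the end of `(A_{k, …, k})^(Δ[k])` at the nondegenerate `k`-simplex. -/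
def diagTopπ (A : MultiSimplex n ⥤ (SimplexCategoryᵒᵖ ⥤ M)) (k : SimplexCategory) :
    (homEnd stdSimplex).obj (diagonal n ⋙ A) ⟶ (A.obj ((diagonal n).obj k)).obj (op k) :=
  homEndπ stdSimplex (diagonal n ⋙ A) k (m := op k) (𝟙 k)

theorem homEndπ_eq_diagTopπ (A : MultiSimplex n ⥤ (SimplexCategoryᵒᵖ ⥤ M)) {k m : SimplexCategory}
    (y : m ⟶ k) :
    homEndπ stdSimplex (diagonal n ⋙ A) k (m := op m) y =
      diagTopπ n A m ≫ (A.map ((diagonal n).map y)).app (op m) := by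
  have h := homEndπ_map (K := stdSimplex) (A := diagonal n ⋙ A) (m := op m) (𝟙 m) y
  refine Eq.trans ?_ h.symm
  congr 1
  exact (Category.id_comp y).symm

/-- Both sides are the component at the simplex `y` of Δ[k]: it is obtained from the identity of `k`
by a simplicial operator and from the identity of `m` by a cosimplicial one. -/
theorem diagTopπ_map (A : MultiSimplex n ⥤ (SimplexCategoryᵒᵖ ⥤ M)) {k m : SimplexCategory}
    (y : m ⟶ k) :
    diagTopπ n A k ≫ (A.obj ((diagonal n).obj k)).map y.op =
      diagTopπ n A m ≫ (A.map ((diagonal n).map y)).app (op m) := by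
  rw [← homEndπ_eq_diagTopπ]
  have h := homEndπ_simplicial (K := stdSimplex) (A := diagonal n ⋙ A) k (m := op k) (𝟙 k) y.op
  refine Eq.trans h ?_
  congr 1
  exact Category.comp_id y

/-- The formula is forced: `x` is the image of the identity simplex of Δ⁽ⁿ⁾(D[m]). Compatibility
with simplicial operators is `diagTopπ_map`. -/
theorem exists_homEnd_extend (A : MultiSimplex n ⥤ (SimplexCategoryᵒᵖ ⥤ M)) :
    ∃ l : (homEnd stdSimplex).obj (diagonal n ⋙ A) ⟶ (homEnd (prodStdSimplex n)).obj A,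
      ∀ (p : MultiSimplex n) (m : SimplexCategoryᵒᵖ) (x : (diagonal n).obj m.unop ⟶ p),
        l ≫ homEndπ (prodStdSimplex n) A p (m := m) x =
          diagTopπ n A m.unop ≫ (A.map x).app m := by
  refine exists_homEnd_lift (K := prodStdSimplex n) (A := A)
    (fun p m x => diagTopπ n A m.unop ≫ (A.map (X := (diagonal n).obj m.unop) x).app m) ?_ ?_
  · intro p m m' x f
    change (diagonal n).obj m.unop ⟶ p at x
    change (diagTopπ n A m.unop ≫ (A.map x).app m) ≫ _ =
      diagTopπ n A m'.unop ≫ (A.map ((diagonal n).map f.unop ≫ x)).app m'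
    rw [Category.assoc, ← (A.map x).naturality, ← Category.assoc, Functor.map_comp,
      NatTrans.comp_app, ← Category.assoc]
    congr 1
    exact diagTopπ_map n A f.unop
  · intro p q m x f
    change (diagonal n).obj m.unop ⟶ p at x
    change (diagTopπ n A m.unop ≫ (A.map x).app m) ≫ _ =
      diagTopπ n A m.unop ≫ (A.map (x ≫ f)).app m
    simp

theorem nonempty_homEnd_diagonal_iso :
    Nonempty (homEnd (M := M) (prodStdSimplex n) ≅
      (Functor.whiskeringLeft _ _ _).obj (diagonal n) ⋙ homEnd stdSimplex) := by
  choose r hr using exists_homEnd_restrict (M := M) n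
  choose e he using exists_homEnd_extend (M := M) n
  have hr' : ∀ A k, r A ≫ diagTopπ n A k =
      homEndπ (prodStdSimplex n) A ((diagonal n).obj k) (m := op k) (𝟙 _) := fun A k => by
    refine (hr A k (op k) (𝟙 k)).trans ?_
    congr 1
  refine ⟨NatIso.ofComponents (fun A => ⟨r A, e A, ?_, ?_⟩) ?_⟩
  · refine homEnd_hom_ext fun p m x => ?_
    change (diagonal n).obj m.unop ⟶ p at x
    rw [Category.assoc, Category.id_comp]
    refine (congrArg _ (he A p m x)).trans ?_
    rw [← Category.assoc, hr']
    refine (homEndπ_map (K := prodStdSimplex n) (A := A) (m := m) (𝟙 _) x).trans ?_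
    congr 1
    exact Category.id_comp x
  · refine homEnd_hom_ext fun k m y => ?_
    rw [Category.assoc, Category.id_comp]
    refine (congrArg _ (hr A k m y)).trans ?_
    rw [he]
    exact (homEndπ_eq_diagTopπ n A (m := m.unop) y).symm
  · intro A B f
    refine homEnd_hom_ext fun k m y => ?_
    rw [Category.assoc]
    refine (congrArg _ (hr B k m y)).trans ?_
    refine (homEnd_map_π f _ _).trans ?_
    rw [Category.assoc]
    refine Eq.symm ((congrArg _ (homEnd_map_π (K := stdSimplex)
      (Functor.whiskerLeft (diagonal n) f) k y)).trans ?_)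
    rw [← Category.assoc, hr]
    rfl

end Diagonal

/-! ### Extending families from boundaries to cosieves -/

section Extensions

variable {C : Type*} [Category C]

/-- Extension of a family of elements of `G`, indexed by a class `S` of morphisms out of `α` and
lying over an element of `F`, to an element of `G` at `α`. -/
def HasExtensions {G F : C ⥤ Type v} (j : G ⟶ F) (α : C) (S : ∀ ⦃β : C⦄, (α ⟶ β) → Prop) : Prop :=
  ∀ (a : F.obj α) (b : ∀ ⦃β : C⦄ (s : α ⟶ β), S s → G.obj β),
    (∀ ⦃β γ : C⦄ (s : α ⟶ β) (t : β ⟶ γ) (hs : S s) (hst : S (s ≫ t)),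
      G.map t (b s hs) = b (s ≫ t) hst) →
    (∀ ⦃β : C⦄ (s : α ⟶ β) (hs : S s), j.app β (b s hs) = F.map s a) →
    ∃ e : G.obj α, j.app α e = a ∧ ∀ ⦃β : C⦄ (s : α ⟶ β) (hs : S s), G.map s e = b s hs

/-- Extension along the boundary of `α`, which consists of the morphisms out of `α` that are not
split monomorphisms. -/
def HasBoundaryExtensions {G F : C ⥤ Type v} (j : G ⟶ F) (α : C) : Prop :=
  HasExtensions j α (fun _ s => ¬ IsSplitMono s)

/-- A class of epimorphisms that, together with the split monomorphisms, factors all morphisms. -/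
structure IsInverseClass (W : MorphismProperty C) : Prop where
  epi : ∀ ⦃α β : C⦄ (e : α ⟶ β), W e → Epi e
  fac : ∀ ⦃α β : C⦄ (s : α ⟶ β), ∃ (γ : C) (e : α ⟶ γ) (m : γ ⟶ β), W e ∧ IsSplitMono m ∧ e ≫ m = s
  cancel : ∀ ⦃α β γ : C⦄ (e : α ⟶ β) (t : β ⟶ γ), W (e ≫ t) → W t
  identities : ∀ ⦃α β : C⦄ (e : α ⟶ β), W e → IsSplitMono e → MorphismProperty.identities C e

theorem not_isSplitMono_comp {α β γ : C} {s : α ⟶ β} (hs : ¬ IsSplitMono s) (t : β ⟶ γ) :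
    ¬ IsSplitMono (s ≫ t) := fun ⟨⟨r⟩⟩ =>
  hs ⟨⟨⟨t ≫ r.retraction, by rw [← Category.assoc, r.id]⟩⟩⟩

/-- In the presence of a degree function that is lowered by the noninvertible maps in `W`, boundary
extensions yield extensions along all cosieves. -/
theorem HasBoundaryExtensions.hasExtensions {W : MorphismProperty C} [W.IsMultiplicative]
    (hW : IsInverseClass W) {deg : C → ℕ}
    (hdeg : ∀ ⦃α β : C⦄ (e : α ⟶ β), W e → ¬ IsSplitMono e → deg β < deg α) {α : C}
    (hfin : {x : Σ β, (α ⟶ β) | W x.2}.Finite)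
    {G F : C ⥤ Type v} {j : G ⟶ F} (hj : ∀ β : C, HasBoundaryExtensions j β)
    (S : ∀ ⦃β : C⦄, (α ⟶ β) → Prop)
    (hS : ∀ ⦃β γ : C⦄ (s : α ⟶ β) (t : β ⟶ γ), S s → S (s ≫ t)) : HasExtensions j α S := by
  -- Induction on the number of maps of `W` out of `α` on which the family is not yet defined.
  induction hN : {x : Σ β, (α ⟶ β) | W x.2 ∧ ¬ S x.2}.ncard using Nat.strong_induction_on
    generalizing S with
  | _ N ih =>
  intro a b hb hab
  by_cases hid : S (𝟙 α)
  · exact ⟨b (𝟙 α) hid, by simpa using hab (𝟙 α) hid, fun β s hs => by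
      have hs' : S (𝟙 α ≫ s) := by simpa using hs
      rw [hb (𝟙 α) s hid hs']
      congr 1
      simp⟩
  have hfin' : {x : Σ β, (α ⟶ β) | W x.2 ∧ ¬ S x.2}.Finite := hfin.subset fun x hx => hx.1
  -- A map `q` outside `S` with target of least degree: by minimality the composites `q ≫ t` in `S`
  -- are exactly those with `t` in the boundary of `β`, so a boundary extension at `β` supplies the
  -- value at `q`.
  obtain ⟨⟨β, q⟩, ⟨hqW, hqS⟩, hmin⟩ := Set.exists_min_image _
    (fun x : Σ β, (α ⟶ β) => deg x.1) hfin' ⟨⟨α, 𝟙 α⟩, W.id_mem α, hid⟩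
  dsimp only at hqW hqS hmin
  have hqepi := hW.epi q hqW
  have hq : ∀ ⦃γ : C⦄ (t : β ⟶ γ), ¬ IsSplitMono t → S (q ≫ t) := by
    intro γ t ht
    obtain ⟨δ, e, m, he, hm, rfl⟩ := hW.fac t
    have he' : ¬ IsSplitMono e := fun h => ht inferInstance
    rw [← Category.assoc]
    apply hS
    by_contra hqe
    exact absurd (hmin ⟨δ, q ≫ e⟩ ⟨W.comp_mem _ _ hqW he, hqe⟩) (not_le.mpr (hdeg e he he'))
  have hq' : ∀ ⦃γ : C⦄ (t : β ⟶ γ), S (q ≫ t) → ¬ IsSplitMono t := fun γ t ht ⟨⟨r⟩⟩ => hqS (by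
    have := hS _ r.retraction ht
    rwa [Category.assoc, r.id, Category.comp_id] at this)
  obtain ⟨bq, hbq, hbq'⟩ := hj β (F.map q a) (fun γ t ht => b (q ≫ t) (hq t ht))
    (fun γ δ t t' ht ht' => by
      have : S ((q ≫ t) ≫ t') := hS _ _ (hq t ht)
      rw [hb (q ≫ t) t' (hq t ht) this]
      congr 1
      simp)
    (fun γ t ht => by rw [hab, Functor.map_comp_apply])
  classical
  -- Enlarge the cosieve by all maps through `q`. Since `q` is an epimorphism, the factor `t` is
  -- unique and the new values do not depend on its choice.
  let S' : ∀ ⦃γ : C⦄, (α ⟶ γ) → Prop := fun γ s => S s ∨ ∃ t : β ⟶ γ, q ≫ t = s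
  let b' : ∀ ⦃γ : C⦄ (s : α ⟶ γ), S' s → G.obj γ := fun γ s hs =>
    if h : S s then b s h else G.map (hs.resolve_left h).choose bq
  have hb'S : ∀ ⦃γ : C⦄ (s : α ⟶ γ) (hs : S' s) (h : S s), b' s hs = b s h :=
    fun γ s hs h => dif_pos h
  have hb'q : ∀ ⦃γ : C⦄ (t : β ⟶ γ) (hs : S' (q ≫ t)), b' (q ≫ t) hs = G.map t bq := by
    intro γ t hs
    by_cases h : S (q ≫ t)
    · rw [hb'S _ hs h, hbq' t (hq' t h)]
    · have : b' (q ≫ t) hs = G.map (hs.resolve_left h).choose bq := dif_neg h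
      rw [this, (cancel_epi q).mp (hs.resolve_left h).choose_spec]
  have hlt : {x : Σ β, (α ⟶ β) | W x.2 ∧ ¬ S' x.2}.ncard < N := by
    rw [← hN]
    refine Set.ncard_lt_ncard ⟨fun x hx => ⟨hx.1, fun h => hx.2 (Or.inl h)⟩, fun h => ?_⟩ hfin'
    exact (h (a := ⟨β, q⟩) ⟨hqW, hqS⟩).2 (Or.inr ⟨𝟙 β, Category.comp_id q⟩)
  obtain ⟨e, he, he'⟩ := ih _ hlt S' (by
      rintro γ δ s t (hs | ⟨u, rfl⟩)
      · exact Or.inl (hS _ _ hs)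
      · exact Or.inr ⟨u ≫ t, (Category.assoc _ _ _).symm⟩) rfl a b' (by
      intro γ δ s t hs hst
      by_cases h : S s
      · rw [hb'S s hs h, hb'S _ hst (hS _ _ h), hb]
      · obtain ⟨u, rfl⟩ := hs.resolve_left h
        rw [hb'q u hs, ← Functor.map_comp_apply]
        have h' : S' (q ≫ u ≫ t) := Or.inr ⟨_, rfl⟩
        rw [← hb'q (u ≫ t) h']
        congr 1
        simp) (by
      intro γ s hs
      by_cases h : S s
      · rw [hb'S s hs h, hab]
      · obtain ⟨u, rfl⟩ := hs.resolve_left h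
        rw [hb'q u hs, NatTrans.naturality_apply, hbq, Functor.map_comp_apply])
  exact ⟨e, he, fun γ s hs => by rw [he' s (Or.inl hs), hb'S s (Or.inl hs) hs]⟩

end Extensions

/-! ### Split monomorphisms and factorizations in Δ and Δⁿ -/

section Simplex

open SimplexCategory

theorem simplex_isSplitMono_iff {k l : SimplexCategory} (f : k ⟶ l) :
    IsSplitMono f ↔ Function.Injective f.toOrderHom := by
  refine ⟨fun h => mono_iff_injective.mp inferInstance, fun h => ?_⟩
  -- The retraction sends `y` to the largest `x` with `f x ≤ y`, and to the vertex 0 (the empty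
  -- supremum) if there is none.
  let r : Fin (l.len + 1) →o Fin (k.len + 1) :=
    { toFun := fun y => (Finset.univ.filter fun x => f.toOrderHom x ≤ y).sup id
      monotone' := fun y y' hy => Finset.sup_mono fun x hx => by
        simp only [Finset.mem_filter, Finset.mem_univ, true_and] at hx ⊢
        exact hx.trans hy }
  refine ⟨⟨⟨Hom.mk r, ?_⟩⟩⟩
  ext x : 3
  change (Finset.univ.filter fun y => f.toOrderHom y ≤ f.toOrderHom x).sup id = x
  have hx : x ∈ Finset.univ.filter fun y => f.toOrderHom y ≤ f.toOrderHom x :=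
    Finset.mem_filter.mpr ⟨Finset.mem_univ x, le_rfl⟩
  refine le_antisymm (Finset.sup_le fun y hy => ?_) (Finset.le_sup (f := id) hx)
  simp only [Finset.mem_filter, Finset.mem_univ, true_and] at hy
  exact (f.toOrderHom.monotone.strictMono_of_injective h).le_iff_le.mp hy

theorem simplex_fac {k l : SimplexCategory} (f : k ⟶ l) :
    ∃ (i : SimplexCategory) (e : k ⟶ i) (m : i ⟶ l), Epi e ∧ IsSplitMono m ∧ e ≫ m = f :=
  ⟨image f, factorThruImage f, image.ι f, inferInstance,
    (simplex_isSplitMono_iff _).mpr (mono_iff_injective.mp inferInstance), image.fac f⟩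

theorem simplex_identities {k l : SimplexCategory} (e : k ⟶ l) [Epi e] [Mono e] :
    MorphismProperty.identities SimplexCategory e := by
  have : IsIso e := isIso_of_mono_of_epi e
  obtain rfl : k = l := skeletal ⟨asIso e⟩
  rw [eq_id_of_isIso e]
  exact (MorphismProperty.identities SimplexCategory).id_mem k

theorem isInverseClass_simplexInverse : IsInverseClass simplexInverse where
  epi _ _ _ he := he
  fac _ _ s := simplex_fac s
  cancel _ _ _ e t h := by
    have h' : Epi (e ≫ t) := h
    exact epi_of_epi e t
  identities _ _ e he he' := by
    have h' : Epi e := he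
    exact simplex_identities e

variable {n : ℕ}

theorem multi_isSplitMono_iff {p q : MultiSimplex n} (f : p ⟶ q) :
    IsSplitMono f ↔ ∀ i, IsSplitMono (f i) := by
  refine ⟨fun ⟨⟨r⟩⟩ i => ⟨⟨⟨r.retraction i, congrFun r.id i⟩⟩⟩, fun h => ?_⟩
  exact ⟨⟨⟨fun i => retraction (f i), funext fun i => IsSplitMono.id (f i)⟩⟩⟩

theorem isInverseClass_multiInverse : IsInverseClass (multiInverse n) where
  epi _ _ _ he := ⟨fun g h hgh => funext fun i => by
    have := he i
    have : Epi _ := this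
    exact (cancel_epi _).mp (congrFun hgh i)⟩
  fac p q s := by
    choose k e m he hm h using fun i => simplex_fac (s i)
    exact ⟨k, e, m, he, (multi_isSplitMono_iff m).mpr hm, funext h⟩
  cancel _ _ _ e t h i := isInverseClass_simplexInverse.cancel (e i) (t i) (h i)
  identities p q e he he' := by
    rw [multi_isSplitMono_iff] at he'
    obtain rfl : p = q := funext fun i => by
      have := he' i
      have : Epi (e i) := he i
      have : IsIso (e i) := isIso_of_mono_of_epi _
      exact skeletal ⟨asIso (e i)⟩
    have : e = 𝟙 p := funext fun i => by
      have := he' i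
      have := he i
      have : Epi (e i) := this
      have : IsIso (e i) := isIso_of_mono_of_epi _
      exact eq_id_of_isIso (e i)
    rw [this]
    exact (MorphismProperty.identities (MultiSimplex n)).id_mem p

theorem multiInverse_deg_lt {p q : MultiSimplex n} (e : p ⟶ q) (he : multiInverse n e)
    (he' : ¬ IsSplitMono e) : ∑ i, (q i).len < ∑ i, (p i).len := by
  have hle : ∀ i, (q i).len ≤ (p i).len := fun i => by
    have : Epi (e i) := he i
    exact len_le_of_epi (e i)
  rw [multi_isSplitMono_iff] at he'
  push Not at he'
  obtain ⟨i, hi⟩ := he'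
  refine Finset.sum_lt_sum (fun i _ => hle i) ⟨i, Finset.mem_univ i, (hle i).lt_of_ne fun h => hi ?_⟩
  have : Epi (e i) := he i
  have := (isIso_iff_of_epi (e i)).mpr h.symm
  infer_instance

theorem finite_multiInverse (p : MultiSimplex n) :
    {x : Σ q, (p ⟶ q) | multiInverse n x.2}.Finite := by
  have hfin : ∀ N : ℕ, {k : SimplexCategory | k.len ≤ N}.Finite := fun N =>
    ((Set.finite_Iic N).image SimplexCategory.mk).subset fun k hk => ⟨k.len, hk, rfl⟩
  have hhom : ∀ k l : SimplexCategory, Finite (k ⟶ l) := fun k l =>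
    
    haveI := Finite.of_injective _ (DFunLike.coe_injective (F := Fin (k.len + 1) →o Fin (l.len + 1)))
    Finite.of_equiv _ homEquivOrderHom.symm
  have : ∀ q : MultiSimplex n, Finite (p ⟶ q) := fun q =>
    inferInstanceAs (Finite (∀ i, p i ⟶ q i))
  refine ((Set.Finite.pi' fun i => hfin (p i).len).biUnion
    fun q _ => Set.finite_range (Sigma.mk q : (p ⟶ q) → Σ q, (p ⟶ q))).subset ?_
  rintro ⟨q, e⟩ he
  refine Set.mem_biUnion (x := q) (fun i => ?_) ⟨e, rfl⟩
  have : Epi (e i) := he i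
  exact len_le_of_epi (e i)

/-- The morphism out of `k` that identifies the vertices that `s₁, …, sₙ` all identify. -/
theorem exists_joint_fac {k : SimplexCategory} {q : MultiSimplex n} (s : (diagonal n).obj k ⟶ q) :
    ∃ (l : SimplexCategory) (ρ : k ⟶ l) (s' : (diagonal n).obj l ⟶ q), Epi ρ ∧
      (diagonal n).map ρ ≫ s' = s ∧
      ∀ x y, ρ.toOrderHom x = ρ.toOrderHom y ↔
        ∀ i, (s i).toOrderHom x = (s i).toOrderHom y := by
  let s₁ : ∀ i, Fin (k.len + 1) →o Fin ((q i).len + 1) := fun i => (s i).toOrderHom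
  -- The sum of the coordinates has the required kernel: for `x ≤ y` each coordinate can only grow,
  -- so equal sums force equal coordinates. The image factorization of this single map gives `ρ`.
  let w : Fin (k.len + 1) →o Fin ((∑ i, (q i).len) + 1) :=
    { toFun := fun x => ⟨∑ i, (s₁ i x).val,
        Nat.lt_succ_of_le (Finset.sum_le_sum fun i _ => Nat.le_of_lt_succ (s₁ i x).isLt)⟩
      monotone' := fun x y hxy => by
        change ∑ i, (s₁ i x).val ≤ ∑ i, (s₁ i y).val
        exact Finset.sum_le_sum fun i _ => (s₁ i).monotone hxy }
  have hw : ∀ x y, w x = w y ↔ ∀ i, s₁ i x = s₁ i y := by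
    have key : ∀ x y, x ≤ y → w x = w y → ∀ i, s₁ i x = s₁ i y := by
      intro x y hxy h i
      have h' : ∑ i, (s₁ i x).val = ∑ i, (s₁ i y).val := congrArg Fin.val h
      exact Fin.ext ((Finset.sum_eq_sum_iff_of_le fun i _ => (s₁ i).monotone hxy).mp h' i
        (Finset.mem_univ i))
    refine fun x y => ⟨fun h => ?_, fun h => ?_⟩
    · rcases le_total x y with hxy | hxy
      · exact key x y hxy h
      · exact fun i => (key y x hxy h.symm i).symm
    · exact Fin.ext (Finset.sum_congr rfl fun i _ => congrArg Fin.val (h i) :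
        ∑ i, (s₁ i x).val = ∑ i, (s₁ i y).val)
  obtain ⟨l, ρ, m, hρ, hm, hfac⟩ :=
    simplex_fac (Hom.mk w : k ⟶ SimplexCategory.mk (∑ i, (q i).len))
  have hker : ∀ x y, ρ.toOrderHom x = ρ.toOrderHom y ↔ ∀ i, s₁ i x = s₁ i y := by
    intro x y
    have hmρ : ∀ x, m.toOrderHom (ρ.toOrderHom x) = w x := fun x =>
      DFunLike.congr_fun (congrArg Hom.toOrderHom hfac) x
    rw [← hw, ← hmρ, ← hmρ, ((simplex_isSplitMono_iff m).mp hm).eq_iff]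
  have := hρ
  have : IsSplitEpi ρ := isSplitEpi_of_epi ρ
  let r : l ⟶ k := section_ ρ
  -- A vertex and its image under `ρ ≫ r` agree under `ρ`, hence under every `s i`.
  refine ⟨l, ρ, fun i => r ≫ s i, hρ, funext fun i => ?_, hker⟩
  change ρ ≫ r ≫ s i = s i
  ext x : 3
  refine (hker _ _).mp ?_ i
  exact DFunLike.congr_fun (congrArg Hom.toOrderHom (IsSplitEpi.id ρ)) (ρ.toOrderHom x)

theorem exists_simplex_fac {k l i : SimplexCategory} (σ : k ⟶ l) [Epi σ] (ρ : k ⟶ i)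
    (h : ∀ x y, σ.toOrderHom x = σ.toOrderHom y → ρ.toOrderHom x = ρ.toOrderHom y) :
    ∃ τ : l ⟶ i, σ ≫ τ = ρ := by
  have : IsSplitEpi σ := isSplitEpi_of_epi σ
  refine ⟨section_ σ ≫ ρ, ?_⟩
  ext x : 3
  exact h _ _ (DFunLike.congr_fun (congrArg Hom.toOrderHom (IsSplitEpi.id σ)) (σ.toOrderHom x))

end Simplex

/-! ### Boundary extensions for a diagram and for its diagonal -/

section DiagonalExtensions

open SimplexCategory

variable {n : ℕ}

/-- `N` is the simplex of dimension p₁ + ⋯ + pₙ, with the [pᵢ] laid end to end as blocks in which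
neighbours share a vertex; `ι i` includes the i-th block and `π i` collapses everything outside it.
Any two consecutive vertices of `N` lie in a common block, so a map that is injective on each block
is injective. -/
theorem exists_concatenation (p : MultiSimplex n) :
    ∃ (N : SimplexCategory) (π : (diagonal n).obj N ⟶ p) (ι : p ⟶ (diagonal n).obj N),
      ι ≫ π = 𝟙 p ∧
      (∀ ⦃k : SimplexCategory⦄ (σ : N ⟶ k), IsSplitMono (ι ≫ (diagonal n).map σ) →
        IsSplitMono σ) ∧
      ∀ i j, j ≠ i → ∀ x y, (π j).toOrderHom ((ι i).toOrderHom x) =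
        (π j).toOrderHom ((ι i).toOrderHom y) := by
  -- Lengths extended by 0 beyond `n`, so that `c m`, the first vertex of block `m`, is a sum over a
  -- range.
  let P : ℕ → ℕ := fun j => if h : j < n then (p ⟨j, h⟩).len else 0
  have hP : ∀ i : Fin n, P i = (p i).len := fun i => dif_pos i.isLt
  let c : ℕ → ℕ := fun m => ∑ j ∈ Finset.range m, P j
  have hc : ∀ i : Fin n, c (i + 1) = c i + (p i).len := fun i => by
    rw [← hP]; exact Finset.sum_range_succ P i
  have hcm : Monotone c := fun a b hab =>
    Finset.sum_le_sum_of_subset (Finset.range_mono hab)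
  have hle : ∀ (i : Fin n) (x : Fin ((p i).len + 1)), c i + x < c n + 1 := fun i x => by
    have h₁ := hcm (Nat.succ_le_of_lt i.isLt)
    have h₂ := hc i
    have h₃ := x.isLt
    simp only [Nat.succ_eq_add_one] at h₁
    omega
  -- Truncated subtraction sends the vertices before the block to 0, and `min` sends those after it
  -- to the last vertex.
  let π : ∀ i, Fin (c n + 1) →o Fin ((p i).len + 1) := fun i =>
    { toFun := fun z => ⟨min (p i).len (z - c i), Nat.lt_succ_of_le (min_le_left _ _)⟩
      monotone' := fun z z' h => by
        have h' : (z : ℕ) ≤ z' := h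
        change min (p i).len (z - c i) ≤ min (p i).len (z' - c i)
        omega }
  let ι : ∀ i, Fin ((p i).len + 1) →o Fin (c n + 1) := fun i =>
    { toFun := fun x => ⟨c i + x, hle i x⟩
      monotone' := fun x x' h => by
        have h' : (x : ℕ) ≤ x' := h
        change c i + x ≤ c i + x'
        omega }
  refine ⟨SimplexCategory.mk (c n), fun i => Hom.mk (π i), fun i => Hom.mk (ι i),
    funext fun i => ?_, fun k σ hσ => ?_, fun i j hij x y => ?_⟩
  · change (Hom.mk (ι i) : p i ⟶ SimplexCategory.mk (c n)) ≫ Hom.mk (π i) = 𝟙 (p i)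
    ext x : 3
    refine Fin.ext ?_
    change min (p i).len (c i + x - c i) = x
    have := x.isLt
    omega
  · rw [multi_isSplitMono_iff] at hσ
    have hinj : ∀ i : Fin n, ∀ x y : Fin ((p i).len + 1),
        σ.toOrderHom (ι i x) = σ.toOrderHom (ι i y) → x = y := fun i =>
      (simplex_isSplitMono_iff _).mp (hσ i)
    have hblock : ∀ (z m : ℕ), z < c m → ∃ i < m, c i ≤ z ∧ z < c (i + 1) := by
      intro z m
      induction m with
      | zero => intro h; simp [c] at h
      | succ m ih =>
        intro h
        by_cases h' : z < c m
        · obtain ⟨i, hi, hi'⟩ := ih h'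
          exact ⟨i, hi.trans (Nat.lt_succ_self m), hi'⟩
        · exact ⟨m, Nat.lt_succ_self m, not_lt.mp h', h⟩
    rw [simplex_isSplitMono_iff]
    refine StrictMono.injective (Fin.strictMono_iff_lt_succ.mpr fun z => ?_)
    refine lt_of_le_of_ne (σ.toOrderHom.monotone (Fin.castSucc_le_succ z)) fun h => ?_
    obtain ⟨i, hi, h₁, h₂⟩ := hblock z n z.isLt
    have hci := hc ⟨i, hi⟩
    dsimp only at hci
    have hx : ι ⟨i, hi⟩ ⟨z - c i, by omega⟩ = z.castSucc := Fin.ext (by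
      change c i + (z - c i) = z
      omega)
    have hy : ι ⟨i, hi⟩ ⟨z + 1 - c i, by omega⟩ = z.succ := Fin.ext (by
      change c i + (z + 1 - c i) = z + 1
      omega)
    have := congrArg Fin.val (hinj ⟨i, hi⟩ ⟨z - c i, by omega⟩ ⟨z + 1 - c i, by omega⟩ (by
      rw [hx, hy]; exact h))
    dsimp only at this
    omega
  · refine Fin.ext ?_
    change min (p j).len (c i + x - c j) = min (p j).len (c i + y - c j)
    have hx := x.isLt
    have hy := y.isLt
    have hci := hc i
    have hcj := hc j
    rcases lt_or_gt_of_ne hij with h | h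
    · have := hcm (Nat.succ_le_of_lt (Fin.lt_def.mp h))
      simp only [Nat.succ_eq_add_one] at this
      omega
    · have := hcm (Nat.succ_le_of_lt (Fin.lt_def.mp h))
      simp only [Nat.succ_eq_add_one] at this
      omega

variable {G F : MultiSimplex n ⥤ Type v} {j : G ⟶ F}

/-- The maps out of D[k] that factor through Dσ for some noninjective σ form a cosieve. The given
family spreads over it along the joint factorization `s = Dρ ≫ s'`, and the extension along this
cosieve solves the problem at `k`. -/
theorem HasBoundaryExtensions.whiskerLeft_diagonal (hj : ∀ p, HasBoundaryExtensions j p)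
    (k : SimplexCategory) :
    HasBoundaryExtensions (Functor.whiskerLeft (diagonal n) j) k := by
  intro a b hb hab
  choose l ρ s' hρ hfac hker using fun q (s : (diagonal n).obj k ⟶ q) => exists_joint_fac s
  have hDepi : ∀ {k l : SimplexCategory} (σ : k ⟶ l) [Epi σ], Epi ((diagonal n).map σ) :=
    fun σ _ => by
      have := isSplitEpi_of_epi σ
      infer_instance
  -- `ρ` is terminal among the epimorphisms through whose diagonals `s` factors. This gives the
  -- cosieve property and the compatibility of the spread family.
  have huniv : ∀ ⦃q : MultiSimplex n⦄ (s : (diagonal n).obj k ⟶ q) ⦃i : SimplexCategory⦄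
      (σ : k ⟶ i) (t : (diagonal n).obj i ⟶ q) (_ : Epi σ),
      (diagonal n).map σ ≫ t = s →
      ∃ τ : i ⟶ l q s, σ ≫ τ = ρ q s ∧ (diagonal n).map τ ≫ s' q s = t := by
    intro q s i σ t _ h
    obtain ⟨τ, hτ⟩ := exists_simplex_fac σ (ρ q s) fun x y hxy => (hker q s x y).mpr fun i => by
      rw [← h]
      exact congrArg (t i).toOrderHom hxy
    refine ⟨τ, hτ, ?_⟩
    have := hDepi σ
    rw [← cancel_epi ((diagonal n).map σ), ← Category.assoc, ← Functor.map_comp, hτ, hfac, h]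
  obtain ⟨e, he, he'⟩ := HasBoundaryExtensions.hasExtensions isInverseClass_multiInverse
    (fun _ _ => multiInverse_deg_lt) (finite_multiInverse ((diagonal n).obj k)) hj
    (fun q s => ¬ IsSplitMono (ρ q s)) (fun q r s t hs => by
      obtain ⟨τ, hτ, -⟩ := huniv (s ≫ t) (ρ q s) (s' q s ≫ t) (hρ q s) (by
        rw [← Category.assoc, hfac])
      rw [← hτ]
      exact not_isSplitMono_comp hs τ) a (fun q s hs => G.map (s' q s) (b (ρ q s) hs)) (by
      intro q r s t hs hst
      obtain ⟨τ, hτ, hτ'⟩ := huniv (s ≫ t) (ρ q s) (s' q s ≫ t) (hρ q s) (by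
        rw [← Category.assoc, hfac])
      rw [← Functor.map_comp_apply, ← hτ', Functor.map_comp_apply]
      congr 1
      have hst' : ¬ IsSplitMono (ρ q s ≫ τ) := by rwa [hτ]
      refine (hb (ρ q s) τ hs hst').trans ?_
      congr 1) (by
      intro q s hs
      rw [NatTrans.naturality_apply]
      have h := hab (ρ q s) hs
      refine (congrArg (F.map (s' q s)) h).trans ?_
      change F.map (s' q s) (F.map ((diagonal n).map (ρ q s)) a) = _
      rw [← Functor.map_comp_apply, hfac])
  refine ⟨e, he, fun i σ hσ => ?_⟩
  obtain ⟨i', ε, m, hε, hm, rfl⟩ := simplex_fac σ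
  have hε' : ¬ IsSplitMono ε := fun h => hσ inferInstance
  rw [← hb ε m hε' hσ]
  change G.map ((diagonal n).map (ε ≫ m)) e = G.map ((diagonal n).map m) _
  rw [Functor.map_comp, Functor.map_comp_apply]
  congr 1
  -- At Dε the spread family returns the original value `b ε`, because Dτ followed by `s'` is the
  -- identity.
  obtain ⟨τ, hτ, hτ'⟩ := huniv ((diagonal n).map ε) ε (𝟙 _) hε (Category.comp_id _)
  have hρε : ¬ IsSplitMono (ρ _ ((diagonal n).map ε)) := by
    rw [← hτ]
    exact not_isSplitMono_comp hε' τ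
  have hετ : ¬ IsSplitMono (ε ≫ τ) := not_isSplitMono_comp hε' τ
  have hbτ : b (ρ _ ((diagonal n).map ε)) hρε = G.map ((diagonal n).map τ) (b ε hε') := by
    refine Eq.trans ?_ (hb ε τ hε' hετ).symm
    congr 1
    exact hτ.symm
  rw [he' _ hρε, hbτ, ← Functor.map_comp_apply, hτ']
  exact Functor.map_id_apply G _ _

/-- A retract argument: the problem at `p` is carried along `ι` to the concatenation `N`, solved
there, and the solution is carried back along `π`. -/
theorem HasBoundaryExtensions.of_whiskerLeft_diagonal
    (hj : ∀ k, HasBoundaryExtensions (Functor.whiskerLeft (diagonal n) j) k)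
    (p : MultiSimplex n) : HasBoundaryExtensions j p := by
  intro a b hb hab
  obtain ⟨N, π, ι, hιπ, hmono, hblock⟩ := exists_concatenation p
  obtain ⟨e, he, he'⟩ := hj N (F.map ι a)
    (fun k σ hσ => b (ι ≫ (diagonal n).map σ) fun h => hσ (hmono σ h))
    (fun k l σ τ hσ hστ => by
      refine (hb (ι ≫ (diagonal n).map σ) ((diagonal n).map τ) _
        (not_isSplitMono_comp (fun h => hσ (hmono σ h)) _)).trans ?_
      congr 1)
    (fun k σ hσ => by
      refine (hab (ι ≫ (diagonal n).map σ) _).trans ?_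
      rw [Functor.map_comp_apply]
      rfl)
  refine ⟨G.map π e, ?_, fun q s hs => ?_⟩
  · rw [NatTrans.naturality_apply]
    refine (congrArg (F.map π) he).trans ?_
    rw [← Functor.map_comp_apply, hιπ, Functor.map_id_apply]
  · obtain ⟨l, ρ, t, hρ, hfac, hker⟩ := exists_joint_fac (π ≫ s)
    -- If `s i` identifies two vertices, then `π ≫ s` identifies their images in block `i` in every
    -- coordinate, the other `π j` being constant on that block. So `π ≫ s` factors through the
    -- diagonal of a noninjective `ρ`, where the solution at `N` is prescribed.
    have hρ' : ¬ IsSplitMono ρ := by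
      replace hs : ¬ IsSplitMono s := hs
      rw [multi_isSplitMono_iff] at hs
      push Not at hs
      obtain ⟨i, hi⟩ := hs
      rw [simplex_isSplitMono_iff, Function.Injective] at hi
      push Not at hi
      obtain ⟨x, y, hxy, hne⟩ := hi
      rw [simplex_isSplitMono_iff]
      intro h
      have hπι : ∀ z, (π i).toOrderHom ((ι i).toOrderHom z) = z := fun z =>
        DFunLike.congr_fun (congrArg Hom.toOrderHom (congrFun hιπ i)) z
      have h' : (ι i).toOrderHom x = (ι i).toOrderHom y := h ((hker _ _).mpr fun j => by
        change (s j).toOrderHom ((π j).toOrderHom _) = (s j).toOrderHom ((π j).toOrderHom _)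
        by_cases hj : j = i
        · subst hj
          rw [hπι, hπι, hxy]
        · rw [hblock i j hj x y])
      exact hne (by rw [← hπι x, h', hπι])
    have h₁ : ¬ IsSplitMono (ι ≫ (diagonal n).map ρ) := fun h => hρ' (hmono ρ h)
    rw [← Functor.map_comp_apply, ← hfac, Functor.map_comp_apply]
    refine (congrArg (G.map t) (he' ρ hρ')).trans ?_
    rw [hb _ t h₁ (not_isSplitMono_comp h₁ t)]
    congr 1
    rw [Category.assoc, hfac, ← Category.assoc, hιπ, Category.id_comp]

end DiagonalExtensions

/-! ### Elements of limit preserving functors at limits -/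

section LimitElements

variable {N : Type u} [Category.{v} N] {J : Type} [SmallCategory J] {K : J ⥤ N} {c : Cone K}

theorem limit_elements_ext (F : N ⥤ Type v) [PreservesLimitsOfSize.{0, 0} F]
    (hc : IsLimit c) {x y : F.obj c.pt} (h : ∀ j, F.map (c.π.app j) x = F.map (c.π.app j) y) :
    x = y :=
  (((Types.isLimit_iff _).mp ⟨isLimitOfPreserves F hc⟩ (fun j => F.map (c.π.app j) y)
    (Types.sectionOfCone (F.mapCone c) y).2).unique h fun _ => rfl)

theorem exists_limit_element (F : N ⥤ Type v) [PreservesLimitsOfSize.{0, 0} F]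
    (hc : IsLimit c) (s : ∀ j, F.obj (K.obj j))
    (hs : ∀ ⦃i j : J⦄ (f : i ⟶ j), F.map (K.map f) (s i) = s j) :
    ∃ x : F.obj c.pt, ∀ j, F.map (c.π.app j) x = s j :=
  ((Types.isLimit_iff _).mp ⟨isLimitOfPreserves F hc⟩ s (fun f => hs f)).exists

end LimitElements

/-! ### Elements of matching objects -/

section MatchingElements

variable {C : Type} [SmallCategory C] (W : MorphismProperty C) [W.IsMultiplicative]
variable {N : Type u} [Category.{v} N] [HasLimitsOfSize.{0, 0} N]

/-- The matching object at `α` as a functor. -/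
def matchingFunctor (N : Type u) [Category.{v} N] [HasLimitsOfSize.{0, 0} N] (α : C) :
    (C ⥤ N) ⥤ N :=
  (Functor.whiskeringLeft _ _ _).obj (matchingForget W α) ⋙ lim

instance matchingFunctor_preservesLimits (α : C) :
    PreservesLimitsOfSize.{0, 0} (matchingFunctor W N α) := by
  unfold matchingFunctor
  infer_instance

theorem preservesLimits_evaluation (α : C) :
    PreservesLimitsOfSize.{0, 0} ((evaluation C N).obj α) :=
  ⟨fun {_} _ => inferInstance⟩

theorem not_isSplitMono_of_not_identities {W : MorphismProperty C} (hW : IsInverseClass W)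
    {α β : C} {e : α ⟶ β} (he : W e) (h : ¬ MorphismProperty.identities C e) : ¬ IsSplitMono e :=
  fun he' => h (hW.identities e he he')

theorem not_identities_of_not_isSplitMono {α β : C} {e : α ⟶ β} (h : ¬ IsSplitMono e) :
    ¬ MorphismProperty.identities C e := by
  rintro ⟨x⟩
  exact h inferInstance

/-- The projection of the matching object of `X` at a map in `W` that is not a split
monomorphism. -/
def matchingπMk (X : C ⥤ N) {α β : C} (e : α ⟶ β) (he : W e) (h : ¬ IsSplitMono e) :
    matchingObj W X α ⟶ X.obj β :=
  matchingπ W X α ⟨MorphismProperty.Under.mk W e he, not_identities_of_not_isSplitMono h⟩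

theorem matchingMap_πMk (X : C ⥤ N) {α β : C} (e : α ⟶ β) (he : W e)
    (h : ¬ IsSplitMono e) : matchingMap W X α ≫ matchingπMk W X e he h = X.map e :=
  matchingMap_π W X α _

theorem matchingπMk_map (X : C ⥤ N) {α β γ : C} {e : α ⟶ β} (he : W e)
    (h : ¬ IsSplitMono e) {e' : α ⟶ γ} (he' : W e') (h' : ¬ IsSplitMono e') (t : β ⟶ γ) (ht : W t)
    (htt : e ≫ t = e') : matchingπMk W X e he h ≫ X.map t = matchingπMk W X e' he' h' := by
  let f : MatchingCategory W α :=
    ⟨MorphismProperty.Under.mk W e he, not_identities_of_not_isSplitMono h⟩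
  let g : MatchingCategory W α :=
    ⟨MorphismProperty.Under.mk W e' he', not_identities_of_not_isSplitMono h'⟩
  let φ : f ⟶ g := ObjectProperty.homMk (MorphismProperty.Under.homMk t htt ht)
  exact limit.w (matchingForget W α ⋙ X) φ

variable {W}

theorem matchingObj_elements_ext (hW : IsInverseClass W) (F : N ⥤ Type v)
    [PreservesLimitsOfSize.{0, 0} F] (X : C ⥤ N) {α : C} {x y : F.obj (matchingObj W X α)}
    (hxy : ∀ ⦃β : C⦄ (e : α ⟶ β) (he : W e) (h : ¬ IsSplitMono e),
      F.map (matchingπMk W X e he h) x = F.map (matchingπMk W X e he h) y) : x = y :=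
  limit_elements_ext F (limit.isLimit (matchingForget W α ⋙ X)) fun f =>
    hxy f.obj.hom f.obj.prop (not_isSplitMono_of_not_identities hW f.obj.prop f.property)

theorem exists_matchingObj_element (hW : IsInverseClass W) (F : N ⥤ Type v)
    [PreservesLimitsOfSize.{0, 0} F] (X : C ⥤ N) {α : C}
    (s : ∀ ⦃β : C⦄ (e : α ⟶ β), W e → ¬ IsSplitMono e → F.obj (X.obj β))
    (hs : ∀ ⦃β γ : C⦄ (e : α ⟶ β) (he : W e) (h : ¬ IsSplitMono e) (e' : α ⟶ γ) (he' : W e')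
      (h' : ¬ IsSplitMono e') (t : β ⟶ γ), e ≫ t = e' → F.map (X.map t) (s e he h) = s e' he' h') :
    ∃ x : F.obj (matchingObj W X α), ∀ ⦃β : C⦄ (e : α ⟶ β) (he : W e) (h : ¬ IsSplitMono e),
      F.map (matchingπMk W X e he h) x = s e he h := by
  have hns : ∀ f : MatchingCategory W α, ¬ IsSplitMono f.obj.hom := fun f =>
    not_isSplitMono_of_not_identities hW f.obj.prop f.property
  obtain ⟨x, hx⟩ := exists_limit_element F (limit.isLimit (matchingForget W α ⋙ X))
    (fun f => s f.obj.hom f.obj.prop (hns f)) (fun f g φ =>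
      hs f.obj.hom f.obj.prop (hns f) g.obj.hom g.obj.prop (hns g) φ.hom.right
        (MorphismProperty.Under.w φ.hom))
  exact ⟨x, fun β e he h => hx ⟨MorphismProperty.Under.mk W e he,
    not_identities_of_not_isSplitMono h⟩⟩

end MatchingElements

/-! ### Lifting tests and Reedy fibrations -/

section LiftingTests

/-- A lifting problem that makes sense in any category: a natural transformation of limit preserving
functors to types. The case of `Hom(B, -) ⟶ Hom(A, -)` is the right lifting property with respect to
a map `A ⟶ B`. -/
structure LiftingTest (N : Type u) [Category.{v} N] where
  boundary : N ⥤ Type v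
  total : N ⥤ Type v
  res : total ⟶ boundary
  preserves_boundary : PreservesLimitsOfSize.{0, 0} boundary
  preserves_total : PreservesLimitsOfSize.{0, 0} total

attribute [instance] LiftingTest.preserves_boundary LiftingTest.preserves_total

namespace LiftingTest

variable {N : Type u} [Category.{v} N] (t : LiftingTest N)

/-- The map `f` has the lifting property tested by `t`. -/
def Lifts {X Y : N} (f : X ⟶ Y) : Prop :=
  ∀ (a : t.boundary.obj X) (y : t.total.obj Y), t.res.app Y y = t.boundary.map f a →
    ∃ e : t.total.obj X, t.res.app X e = a ∧ t.total.map f e = y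

theorem lifts_comp_iso_iff {X Y Z : N} (f : X ⟶ Y) (g : Y ⟶ Z) [IsIso g] :
    t.Lifts (f ≫ g) ↔ t.Lifts f := by
  constructor
  · intro h a y hy
    obtain ⟨e, he, he'⟩ := h a (t.total.map g y) (by
      rw [NatTrans.naturality_apply, hy, Functor.map_comp_apply])
    refine ⟨e, he, ?_⟩
    have := congrArg (t.total.map (inv g)) he'
    rwa [← Functor.map_comp_apply, ← Functor.map_comp_apply, Category.assoc, IsIso.hom_inv_id,
      Category.comp_id, Functor.map_id_apply] at this
  · intro h a y hy
    obtain ⟨e, he, he'⟩ := h a (t.total.map (inv g) y) (by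
      rw [NatTrans.naturality_apply, hy, ← Functor.map_comp_apply, Category.assoc,
        IsIso.hom_inv_id, Category.comp_id])
    refine ⟨e, he, ?_⟩
    rw [Functor.map_comp_apply, he', ← Functor.map_comp_apply, IsIso.inv_hom_id,
      Functor.map_id_apply]

/-- The lifting property with respect to a map. -/
def ofHom {A B : N} (i : A ⟶ B) : LiftingTest N where
  boundary := coyoneda.obj (op A)
  total := coyoneda.obj (op B)
  res := coyoneda.map i.op
  preserves_boundary := inferInstance
  preserves_total := inferInstance

theorem ofHom_lifts_iff {A B X Y : N} (i : A ⟶ B) (f : X ⟶ Y) :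
    (ofHom i).Lifts f ↔ HasLiftingProperty i f := by
  constructor
  · intro h
    refine ⟨fun {a y} sq => ?_⟩
    obtain ⟨e, he, he'⟩ := h a y sq.w.symm
    exact ⟨⟨⟨e, he, he'⟩⟩⟩
  · intro h (a : A ⟶ X) (y : B ⟶ Y) (hy : i ≫ y = a ≫ f)
    have sq : CommSq a i f y := ⟨hy.symm⟩
    exact ⟨sq.lift, sq.fac_left, sq.fac_right⟩

section Reedy

variable {C : Type} [SmallCategory C] (W : MorphismProperty C) [W.IsMultiplicative]
variable [HasLimitsOfSize.{0, 0} N]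

/-- The boundaries of the Reedy lifting problem at `α`. -/
def reedyBoundary (α : C) : (C ⥤ N) ⥤ Type v where
  obj X := { x : t.boundary.obj (X.obj α) × t.total.obj (matchingObj W X α) //
    t.res.app _ x.2 = t.boundary.map (matchingMap W X α) x.1 }
  map {X Y} f := ↾fun x => ⟨⟨t.boundary.map (f.app α) x.1.1,
      t.total.map (matchingObjMap W f α) x.1.2⟩, by
    dsimp only
    rw [NatTrans.naturality_apply, x.2, ← Functor.map_comp_apply, ← Functor.map_comp_apply,
      matchingMap_naturality]⟩
  map_id X := by
    refine ConcreteCategory.hom_ext _ _ fun x => Subtype.ext (Prod.ext ?_ ?_)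
    · exact Functor.map_id_apply t.boundary _ _
    · exact Functor.map_id_apply (matchingFunctor W N α ⋙ t.total) X x.1.2
  map_comp {X Y Z} f g := by
    refine ConcreteCategory.hom_ext _ _ fun x => Subtype.ext (Prod.ext ?_ ?_)
    · exact Functor.map_comp_apply t.boundary _ _ _
    · exact Functor.map_comp_apply (matchingFunctor W N α ⋙ t.total) f g x.1.2

/-- A fibre product of limit preserving functors, since forming matching objects preserves limits:
the two components are found separately, and their compatibility is checked after projection. -/
theorem reedyBoundary_preservesLimits (α : C) :
    PreservesLimitsOfSize.{0, 0} (t.reedyBoundary W α) := by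
  have := preservesLimits_evaluation (N := N) α
  refine ⟨fun {J} _ => ⟨fun {K} => ⟨fun {c} hc => (Types.isLimit_iff _).mpr fun s hs => ?_⟩⟩⟩
  have hs' : ∀ ⦃i j : J⦄ (f : i ⟶ j), (t.reedyBoundary W α).map (K.map f) (s i) = s j :=
    fun i j f => hs f
  obtain ⟨(a : t.boundary.obj (c.pt.obj α)), ha⟩ :=
    exists_limit_element ((evaluation C N).obj α ⋙ t.boundary) hc
    (fun j => (s j).1.1) (fun i j f => congrArg (fun x => x.1.1) (hs' f))
  obtain ⟨(b : t.total.obj (matchingObj W c.pt α)), hb⟩ :=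
    exists_limit_element (matchingFunctor W N α ⋙ t.total) hc
    (fun j => (s j).1.2) (fun i j f => congrArg (fun x => x.1.2) (hs' f))
  refine ⟨⟨⟨a, b⟩, ?_⟩, fun j => Subtype.ext (Prod.ext (ha j) (hb j)), fun y hy => ?_⟩
  · refine limit_elements_ext (matchingFunctor W N α ⋙ t.boundary) hc fun j => ?_
    change t.boundary.map (matchingObjMap W (c.π.app j) α) (t.res.app _ b) =
      t.boundary.map (matchingObjMap W (c.π.app j) α) (t.boundary.map (matchingMap W c.pt α) a)
    rw [← NatTrans.naturality_apply, ← Functor.map_comp_apply, ← matchingMap_naturality,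
      Functor.map_comp_apply]
    refine (congrArg (t.res.app _) (hb j)).trans (Eq.trans (s j).2 ?_)
    exact congrArg _ (ha j).symm
  · refine Subtype.ext (Prod.ext ?_ ?_)
    · refine limit_elements_ext ((evaluation C N).obj α ⋙ t.boundary) hc fun j => ?_
      exact (congrArg (fun x => x.1.1) (hy j)).trans (ha j).symm
    · refine limit_elements_ext (matchingFunctor W N α ⋙ t.total) hc fun j => ?_
      exact (congrArg (fun x => x.1.2) (hy j)).trans (hb j).symm

/-- The lifting test on diagrams that applies `t` to the relative matching map at `α`. -/
def reedy (α : C) : LiftingTest (C ⥤ N) where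
  boundary := t.reedyBoundary W α
  total := (evaluation C N).obj α ⋙ t.total
  res :=
    { app X := ↾fun e => ⟨⟨t.res.app _ e, t.total.map (matchingMap W X α) e⟩,
        NatTrans.naturality_apply _ _ _⟩
      naturality X Y f := by
        refine ConcreteCategory.hom_ext _ _ fun e => Subtype.ext (Prod.ext ?_ ?_)
        · exact NatTrans.naturality_apply _ _ _
        · change t.total.map _ (t.total.map (f.app α) e) = t.total.map _ (t.total.map _ e)
          rw [← Functor.map_comp_apply, ← Functor.map_comp_apply, matchingMap_naturality] }
  preserves_boundary := t.reedyBoundary_preservesLimits W α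
  preserves_total := by
    have := preservesLimits_evaluation (N := N) α
    infer_instance

/-- Both functors of `t` take the pullback in the relative matching map to a pullback of sets, so
the two lifting problems have the same data and the same solutions. -/
theorem reedy_lifts_iff (α : C) {X Y : C ⥤ N} (f : X ⟶ Y) :
    (t.reedy W α).Lifts f ↔ t.Lifts (relMatchingMap W f α) := by
  have hpb := IsPullback.of_hasPullback (matchingMap W Y α) (matchingObjMap W f α)
  have hA := (Types.isPullback_iff _ _ _ _).mp (hpb.map t.boundary)
  have hB := (Types.isPullback_iff _ _ _ _).mp (hpb.map t.total)
  have h₁ : relMatchingMap W f α ≫ pullback.fst _ _ = f.app α := pullback.lift_fst _ _ _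
  have h₂ : relMatchingMap W f α ≫ pullback.snd _ _ = matchingMap W X α := pullback.lift_snd _ _ _
  constructor
  · intro h a z hz
    have hz₁ := congrArg (t.boundary.map (pullback.fst _ _)) hz
    have hz₂ := congrArg (t.boundary.map (pullback.snd _ _)) hz
    rw [← NatTrans.naturality_apply, ← Functor.map_comp_apply, h₁] at hz₁
    rw [← NatTrans.naturality_apply, ← Functor.map_comp_apply, h₂] at hz₂
    obtain ⟨(e : t.total.obj (X.obj α)), he, he'⟩ := h ⟨⟨a, t.total.map (pullback.snd _ _) z⟩, hz₂⟩
      (t.total.map (pullback.fst _ _) z) (Subtype.ext (Prod.ext hz₁ (by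
        change t.total.map _ (t.total.map _ _) = t.total.map _ (t.total.map _ _)
        rw [← Functor.map_comp_apply, ← Functor.map_comp_apply, pullback.condition])))
    refine ⟨e, congrArg (fun x => x.1.1) he, hB.2.1 _ _ ⟨?_, ?_⟩⟩
    · rw [← Functor.map_comp_apply, h₁]
      exact he'
    · rw [← Functor.map_comp_apply, h₂]
      exact congrArg (fun x => x.1.2) he
  · rintro h ⟨⟨a, b⟩, hab⟩ (y : t.total.obj (Y.obj α)) hy
    have hy₁ : t.res.app _ y = t.boundary.map (f.app α) a := congrArg (fun x => x.1.1) hy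
    have hy₂ : t.total.map (matchingMap W Y α) y = t.total.map (matchingObjMap W f α) b :=
      congrArg (fun x => x.1.2) hy
    obtain ⟨z, hz₁, hz₂⟩ := hB.2.2 y b hy₂
    obtain ⟨e, he, he'⟩ := h a z (hA.2.1 _ _ ⟨by
      rw [← NatTrans.naturality_apply, ← Functor.map_comp_apply, h₁, hz₁, hy₁], by
      rw [← NatTrans.naturality_apply, ← Functor.map_comp_apply, h₂, hz₂]
      exact hab⟩)
    refine ⟨e, Subtype.ext (Prod.ext he ?_), ?_⟩
    · change t.total.map _ e = b
      rw [← h₂, Functor.map_comp_apply, he', hz₂]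
    · change t.total.map (f.app α) e = y
      rw [← h₁, Functor.map_comp_apply, he', hz₁]

/-- Evaluation and matching objects preserve terminal objects, so the pullback projects
isomorphically onto the matching object of `X`. -/
theorem lifts_relMatchingMap_terminal_iff (X : C ⥤ N) (α : C) :
    t.Lifts (relMatchingMap W (terminal.from X) α) ↔ t.Lifts (matchingMap W X α) := by
  have := preservesLimits_evaluation (N := N) α
  have h₁ : IsTerminal ((⊤_ (C ⥤ N)).obj α) :=
    IsTerminal.isTerminalObj ((evaluation C N).obj α) _ terminalIsTerminal
  have h₂ : IsTerminal (matchingObj W (⊤_ (C ⥤ N)) α) :=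
    IsTerminal.isTerminalObj (matchingFunctor W N α) _ terminalIsTerminal
  have : IsIso (matchingMap W (⊤_ (C ⥤ N)) α) := isIso_of_isTerminal h₁ h₂ _
  have h : relMatchingMap W (terminal.from X) α ≫ pullback.snd _ _ = matchingMap W X α :=
    pullback.lift_snd _ _ _
  rw [← h, lifts_comp_iso_iff]

variable {W}

/-- An element over the matching object is a compatible family on the nonidentity maps of `W` out of
`α`. It extends uniquely to all non-split-monomorphisms, since each is such a map followed by a
split monomorphism. -/
theorem lifts_matchingMap_iff (hW : IsInverseClass W) (X : C ⥤ N) (α : C) :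
    t.Lifts (matchingMap W X α) ↔ HasBoundaryExtensions (Functor.whiskerLeft X t.res) α := by
  constructor
  · intro h (a : t.boundary.obj (X.obj α))
      (b : ∀ ⦃β : C⦄ (s : α ⟶ β), ¬ IsSplitMono s → t.total.obj (X.obj β)) hb hab
    have hb' : ∀ ⦃β γ : C⦄ (s : α ⟶ β) (u : β ⟶ γ) (hs : ¬ IsSplitMono s)
      (hsu : ¬ IsSplitMono (s ≫ u)), t.total.map (X.map u) (b s hs) = b (s ≫ u) hsu := hb
    have hab' : ∀ ⦃β : C⦄ (s : α ⟶ β) (hs : ¬ IsSplitMono s),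
      t.res.app _ (b s hs) = t.boundary.map (X.map s) a := hab
    obtain ⟨y, hy⟩ := exists_matchingObj_element hW t.total X (fun β s _ hs => b s hs) (by
      rintro β γ e he h e' he' h' u rfl
      exact hb' e u h h')
    obtain ⟨e, he, he'⟩ := h a y (matchingObj_elements_ext hW t.boundary X fun β ε hε hε' => by
      rw [← NatTrans.naturality_apply, hy, ← Functor.map_comp_apply, matchingMap_πMk, hab'])
    refine ⟨e, he, fun β s hs => ?_⟩
    change t.total.map (X.map s) e = b s hs
    obtain ⟨γ, ε, m, hε, hm, rfl⟩ := hW.fac s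
    have hε' : ¬ IsSplitMono ε := fun h => hs inferInstance
    rw [← hb' ε m hε' hs, ← hy ε hε hε', ← he', ← Functor.map_comp_apply,
      ← Functor.map_comp_apply, ← Category.assoc, matchingMap_πMk, X.map_comp]
  · intro h a y hy
    -- The extended value does not depend on the factorization: a retraction of `m` yields a map of
    -- `W` from the second factorization to the first.
    have hwd : ∀ ⦃β γ γ' : C⦄ (ε : α ⟶ γ) (hε : W ε) (hε' : ¬ IsSplitMono ε) (m : γ ⟶ β)
        (_ : IsSplitMono m) (ε₁ : α ⟶ γ') (hε₁ : W ε₁) (hε₁' : ¬ IsSplitMono ε₁) (m₁ : γ' ⟶ β),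
        ε ≫ m = ε₁ ≫ m₁ →
        matchingπMk W X ε hε hε' ≫ X.map m = matchingπMk W X ε₁ hε₁ hε₁' ≫ X.map m₁ := by
      intro β γ γ' ε hε hε' m hm ε₁ hε₁ hε₁' m₁ hfac
      have hτ : ε₁ ≫ m₁ ≫ retraction m = ε := by
        rw [← Category.assoc, ← hfac, Category.assoc, IsSplitMono.id, Category.comp_id]
      have hW' : W (m₁ ≫ retraction m) := hW.cancel ε₁ _ (by rwa [hτ])
      have hm₁ : (m₁ ≫ retraction m) ≫ m = m₁ := by
        have := hW.epi ε₁ hε₁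
        rw [← cancel_epi ε₁, ← Category.assoc, hτ, hfac]
      rw [← matchingπMk_map W X hε₁ hε₁' hε hε' _ hW' hτ, Category.assoc, ← X.map_comp, hm₁]
    choose γ ε m hε hm hfac using fun β (s : α ⟶ β) => hW.fac s
    have hns : ∀ ⦃β : C⦄ (s : α ⟶ β), ¬ IsSplitMono s → ¬ IsSplitMono (ε β s) := fun β s hs h => by
      have := hm β s
      exact hs (by rw [← hfac β s]; infer_instance)
    obtain ⟨(e : t.total.obj (X.obj α)), he, he'⟩ := h a (fun β s hs => t.total.map
      (matchingπMk W X (ε β s) (hε β s) (hns s hs) ≫ X.map (m β s)) y) (by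
        intro β δ s u hs hsu
        change t.total.map (X.map u) (t.total.map _ y) = t.total.map _ y
        rw [← Functor.map_comp_apply, Category.assoc, ← X.map_comp]
        congr 3
        exact (hwd _ _ _ _ (hm _ _) _ _ _ _ (by rw [hfac, ← Category.assoc, hfac])).symm) (by
        intro β s hs
        change t.res.app _ (t.total.map _ y) = t.boundary.map (X.map s) a
        rw [NatTrans.naturality_apply, hy, ← Functor.map_comp_apply, ← Category.assoc,
          matchingMap_πMk, ← X.map_comp, hfac])
    have he'' : ∀ ⦃β : C⦄ (s : α ⟶ β) (hs : ¬ IsSplitMono s), t.total.map (X.map s) e =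
      t.total.map (matchingπMk W X (ε β s) (hε β s) (hns s hs) ≫ X.map (m β s)) y := he'
    refine ⟨e, he, matchingObj_elements_ext hW t.total X fun β s hs hs' => ?_⟩
    rw [← Functor.map_comp_apply, matchingMap_πMk, he'' s hs',
      hwd _ _ _ _ (hm _ _) s hs hs' (𝟙 _) (by rw [hfac, Category.comp_id]),
      CategoryTheory.Functor.map_id, Category.comp_id]

end Reedy

end LiftingTest

end LiftingTests

/-! ### Reedy fibrancy of diagonals and of frames -/

section Diagonal

variable {N : Type u} [Category.{v} N]

/-- The class `P` consists of the maps that pass all the tests in `T`. -/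
def IsDetectedBy (P : MorphismProperty N) (T : Set (LiftingTest N)) : Prop :=
  ∀ ⦃X Y : N⦄ (f : X ⟶ Y), P f ↔ ∀ t ∈ T, t.Lifts f

theorem exists_isDetectedBy_fibrations (M : Type u) [Category.{v} M] [ModelCategory M] :
    ∃ T, IsDetectedBy (HomotopicalAlgebra.fibrations M) T := by
  refine ⟨{t | ∃ (A B : M) (i : A ⟶ B), trivialCofibrations M i ∧ t = .ofHom i},
    fun X Y f => ?_⟩
  rw [← trivialCofibrations_rlp]
  constructor
  · rintro h _ ⟨A, B, i, hi, rfl⟩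
    exact (LiftingTest.ofHom_lifts_iff i f).mpr (h i hi)
  · intro h A B i hi
    exact (LiftingTest.ofHom_lifts_iff i f).mp (h _ ⟨A, B, i, hi, rfl⟩)

variable [HasLimitsOfSize.{0, 0} N] {P : MorphismProperty N} {T : Set (LiftingTest N)}

/-- Detection by tests passes to diagram categories, so the fibrancy criterion applies to simplicial
objects as well as to the model category itself. -/
theorem IsDetectedBy.reedyFibrations {C : Type} [SmallCategory C] (W : MorphismProperty C)
    [W.IsMultiplicative] (hP : IsDetectedBy P T) :
    IsDetectedBy (reedyFibrations W P) {t | ∃ t' ∈ T, ∃ α, t = t'.reedy W α} := by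
  intro X Y f
  constructor
  · rintro h _ ⟨t, ht, α, rfl⟩
    exact (t.reedy_lifts_iff W α f).mpr ((hP _).mp (h α) t ht)
  · intro h α
    exact (hP _).mpr fun t ht => (t.reedy_lifts_iff W α f).mp (h _ ⟨t, ht, α, rfl⟩)

theorem IsDetectedBy.isFibrantDiagram_iff {C : Type} [SmallCategory C] {W : MorphismProperty C}
    [W.IsMultiplicative] (hP : IsDetectedBy P T) (hW : IsInverseClass W) (X : C ⥤ N) :
    IsFibrantDiagram W P X ↔
      ∀ t ∈ T, ∀ α, HasBoundaryExtensions (Functor.whiskerLeft X t.res) α := by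
  have h : ∀ α, P (relMatchingMap W (terminal.from X) α) ↔
      ∀ t ∈ T, HasBoundaryExtensions (Functor.whiskerLeft X t.res) α := fun α => by
    rw [hP]
    refine forall₂_congr fun t _ => ?_
    rw [t.lifts_relMatchingMap_terminal_iff, t.lifts_matchingMap_iff hW]
  exact ⟨fun hX t ht α => (h α).mp (hX α) t ht, fun hX α => (h α).mpr fun t ht => hX t ht α⟩

/-- An `n`-cosimplicial object is Reedy fibrant if and only if its diagonal is. -/
theorem IsDetectedBy.isFibrantDiagram_diagonal_iff (hP : IsDetectedBy P T) {n : ℕ}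
    (X : MultiSimplex n ⥤ N) :
    IsFibrantDiagram simplexInverse P (diagonal n ⋙ X) ↔ IsFibrantDiagram (multiInverse n) P X := by
  rw [hP.isFibrantDiagram_iff isInverseClass_simplexInverse,
    hP.isFibrantDiagram_iff isInverseClass_multiInverse]
  exact ⟨fun h t ht => HasBoundaryExtensions.of_whiskerLeft_diagonal (h t ht),
    fun h t ht => HasBoundaryExtensions.whiskerLeft_diagonal (h t ht)⟩

/-- The objectwise conditions are those at the objects D[k]. Fibrancy goes from diag X back to X,
through the frame on X, and on to its diagonal. -/
theorem isReedyFrame_diagJ {M : Type u} [Category.{v} M] [ModelCategory M]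
    [HasLimitsOfSize.{0, 0} M] {n : ℕ} (X : FramedDiagram M (multiInverse n)) :
    IsReedyFrame simplexInverse (diagJ X.j) := by
  obtain ⟨T, hT⟩ := exists_isDetectedBy_fibrations M
  refine ⟨fun k => ?_, fun h => ?_⟩
  · have : (diagJ X.j).app k = X.j.app ((diagonal n).obj k) := Category.id_comp _
    rw [this]
    exact X.isReedyFrame.isFrame _
  · exact ((hT.reedyFibrations simplexOpInverse).isFibrantDiagram_diagonal_iff X.frame).mpr
      (X.isReedyFrame.fibrant ((hT.isFibrantDiagram_diagonal_iff X.diagram).mp h))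

end Diagonal

end Reedy

end

theorem mainTheorem6 (n : ℕ) (hn : 0 < n)
    (M : Type u) [Category.{v} M] [ModelCategory M] [HasLimits M] :
    ∃ h : ∀ X : Reedy.FramedDiagram M (Reedy.multiInverse n),
        Reedy.IsReedyFrame Reedy.simplexInverse (Reedy.diagJ X.j),
      Nonempty (Reedy.multiTot M n ≅ Reedy.diagFunctor h ⋙ Reedy.tot M) := by
  obtain ⟨e⟩ := Reedy.nonempty_homEnd_diagonal_iso (M := M) n
  exact ⟨Reedy.isReedyFrame_diagJ, ⟨Functor.isoWhiskerLeft Reedy.FramedDiagram.frameFunctor e⟩⟩
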